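/- Let $\tilde m\in C^\infty([-1,1])$ be positive on $[-1,1]$, let $m(u)=(1-u^2)\tilde m(u)$ be even, and put $$\sigma=\int_{-1}^1\sqrt{1-u^2}\,du,\qquad \delta=4\Big(\int_{-1}^1\frac{m(u)}{\sqrt{1-u^2}}\,du\Big)^{-1},\qquad \omega=\int_{-1}^1\tilde m(u)\sqrt{1-u^2}\,du,\qquad \hat m(u)=\frac{m(u)}{\sqrt{1-u^2}} .$$ Let $\Gamma\subset\mathbb R^d$, $d\ge2$, be a smooth, compact, connected, embedded hypersurface without boundary. For $\epsilon\in(0,1)$ let $n_\epsilon(u)=1+\epsilon u$, let $A_\epsilon,\tau_\epsilon\in C^\infty([-1,1])$ satisfy $A_\epsilon^2\tau_\epsilon=n_\epsilon^4\tilde m$, and let $$a_\epsilon=\frac{1}{A_\epsilon^2\tau_\epsilon}\Big(\frac{n_\epsilon^2}{n_\epsilon'}\Big)^2\frac1{\sqrt{1-u^2}},\qquad \mathcal C_\epsilon f=\int_{-1}^1\Big(f+\frac{n_\epsilon}{n_\epsilon'}\partial_uf\Big)du,\qquad (f,g)_{\mathcal E_\epsilon}=\int_\Gamma\int_{-1}^1\big(a_\epsilon\,\partial_uf\,\partial_ug+\hat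 m\,\nabla_\Gamma f\cdot\nabla_\Gamma g\big)\,du\,d\mathcal H^{d-1}.$$ Let $H_\epsilon$ be the completion of $\{f\in C^\infty(\Gamma\times[-1,1]):\sqrt{a_\epsilon}\,\partial_uf\in L^2,\ \mathcal C_\epsilon f\in H^1(\Gamma)\}$ with respect to the inner product $(f,g)_{\mathcal E_\epsilon}+(\mathcal C_\epsilon f,\mathcal C_\epsilon g)_{H^1(\Gamma)}$. The propagation operator $\mathcal G_\epsilon:H^1(\Gamma)\to H^1(\Gamma)^*$ of the third-order interface law is the bounded linear operator that maps $\kappa$ to the functional $V$ for which some $f\in H_\epsilon$ satisfies $$(f,\varphi)_{\mathcal E_\epsilon}=\langle V,\mathcal C_\epsilon\varphi\rangle\quad\text{for all }\varphi\in H_\epsilon,\qquad \mathcal C_\epsilon f=\sigma\kappa .$$ Let $\mathcal T=-\sigma(\delta\,\mathrm{Id}-\omega\Delta_\Gamma)^{-1}\Delta_\Gamma:H^1(\Gamma)\to H^1(\Gamma)$ be the intermediate surface diffusion operator (defined weakly). For every $R$ there are $C>0$ and $\epsilon_0\in(0,1]$, depending only on $\tilde m$ and $R$, such that for all such $d$,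 $\Gamma$, $A_\epsilon$, $\tau_\epsilon$ and all $0<\epsilon<\epsilon_0$ the following holds. 1. Each of the operators $\mathcal G_\epsilon$ and $\mathcal T$ exists and is uniquely determined by its definition. 2. There is a function $\rho_\epsilon$ with $|\rho_\epsilon(\lambda)|\le C\epsilon$ and $\delta+\omega\lambda+\rho_\epsilon(\lambda)>0$ for all $0<\lambda\le R$ such that, for each eigenvalue $\lambda\in(0,R]$ of $-\Delta_\Gamma$ and each $L^2(\Gamma)$-normalised eigenfunction $e$ of $-\Delta_\Gamma$ with eigenvalue $\lambda$, the symbol $\zeta_\epsilon(\lambda):=\langle\mathcal G_\epsilon e,e\rangle$ equals $$\zeta_\epsilon(\lambda)=\sigma\lambda\,\big(\delta+\omega\lambda+\rho_\epsilon(\lambda)\big)^{-1}.$$ 3. At frequencies bounded by $R$, the operator $\mathcal G_\epsilon$ recovers $\mathcal T$: for every finite linear combination $\kappa$ of eigenfunctions of $-\Delta_\Gamma$ with eigenvalues in $(0,R]$ and every $\psi\in H^1(\Gamma)$, $$\big|\langle\mathcal G_\epsilon\kappa,\psi\rangle-(\mathcal T\kappa,\psi)_{L^2(\Gamma)}\big|\le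 C\,\epsilon\,\|\kappa\|_{L^2(\Gamma)}\,\|\psi\|_{L^2(\Gamma)} .$$ -/

import Mathlib

open MeasureTheory Set
open scoped ContDiff

namespace ViscoPhase

noncomputable section

/-! ### Smooth closed hypersurfaces in Euclidean space -/

/-- Euclidean space `ℝ^d`. -/
abbrev Space (d : ℕ) : Type := EuclideanSpace ℝ (Fin d)

/-- A smooth, closed (compact, without boundary), connected, embedded hypersurface of `ℝ^d`:
a compact connected set which near each of its points is a regular level set of a smooth
function. -/
structure IsClosedHypersurface {d : ℕ} (Γ : Set (Space d)) : Prop where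
  isCompact : IsCompact Γ
  isConnected : IsConnected Γ
  exists_local_equation : ∀ x ∈ Γ, ∃ (U : Set (Space d)) (Φ : Space d → ℝ),
    IsOpen U ∧ x ∈ U ∧ ContDiffOn ℝ ∞ Φ U ∧ (∀ y ∈ U, fderiv ℝ Φ y ≠ 0) ∧
      Γ ∩ U = {y ∈ U | Φ y = 0}

/-- The tangent space of `Γ` at `x` (for a hypersurface the tangent cone is a linear space). -/
def tangentSpace {d : ℕ} (Γ : Set (Space d)) (x : Space d) : Submodule ℝ (Space d) :=
  Submodule.span ℝ (tangentConeAt ℝ Γ x)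

/-- The surface gradient `∇_Γ h (x)` of (the restriction to `Γ` of) a function `h` which is smooth
on `ℝ^d`: the orthogonal projection of the Euclidean gradient to the tangent space. -/
def surfaceGradient {d : ℕ} (Γ : Set (Space d)) (h : Space d → ℝ) (x : Space d) : Space d :=
  (tangentSpace Γ x).starProjection (gradient h x)

/-- The surface measure: the `(d-1)`-dimensional Hausdorff measure on `Γ`, normalised so that it
agrees with Lebesgue measure on flat pieces. -/
def surfaceMeasure {d : ℕ} (Γ : Set (Space d)) : Measure (Space d) :=
  (Measure.euclideanHausdorffMeasure (d - 1)).restrict Γ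

/-- The product of the surface measure on `Γ` and the Lebesgue measure on `[-1,1]`. -/
def cylinderMeasure {d : ℕ} (Γ : Set (Space d)) : Measure (Space d × ℝ) :=
  (surfaceMeasure Γ).prod (volume.restrict (Icc (-1 : ℝ) 1))

/-! ### The Sobolev space `H¹(Γ)` and the Laplace--Beltrami operator -/

/-- `L²(Γ) × L²(Γ; ℝ^d)`, a Hilbert space with the sum of the two inner products. -/
abbrev SobolevAmbient {d : ℕ} (Γ : Set (Space d)) : Type :=
  WithLp 2 (Lp ℝ 2 (surfaceMeasure Γ) × Lp (Space d) 2 (surfaceMeasure Γ))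

/-- `H¹(Γ)`, the completion of `C^∞(Γ)` with respect to the `H¹`-norm, realised as the closure of
the set of all pairs `(h, ∇_Γ h)`, `h ∈ C^∞(Γ)`, in `L²(Γ) × L²(Γ; ℝ^d)`. -/
def H1 {d : ℕ} (Γ : Set (Space d)) : Submodule ℝ (SobolevAmbient Γ) :=
  (Submodule.span ℝ {p : SobolevAmbient Γ | ∃ h : Space d → ℝ, ContDiff ℝ ∞ h ∧
    p.fst =ᵐ[surfaceMeasure Γ] h ∧
    p.snd =ᵐ[surfaceMeasure Γ] surfaceGradient Γ h}).topologicalClosure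

/-- The `L²(Γ)`-function underlying an element of `H¹(Γ)`. -/
def l2Part {d : ℕ} {Γ : Set (Space d)} (h : H1 Γ) : Lp ℝ 2 (surfaceMeasure Γ) :=
  (h : SobolevAmbient Γ).fst

/-- The surface gradient of an element of `H¹(Γ)`. -/
def gradPart {d : ℕ} {Γ : Set (Space d)} (h : H1 Γ) : Lp (Space d) 2 (surfaceMeasure Γ) :=
  (h : SobolevAmbient Γ).snd

/-- `-Δ_Γ e = lam e` in the weak sense, where `e ∈ H¹(Γ)`. -/
def IsEigenvector {d : ℕ} {Γ : Set (Space d)} (lam : ℝ) (e : H1 Γ) : Prop :=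
  ∀ ψ : H1 Γ, inner ℝ (gradPart e) (gradPart ψ) = lam * inner ℝ (l2Part e) (l2Part ψ)

/-! ### Coefficients

In the following, `m` is the mobility, `n` the coupling function, and `B` stands for the product
`A² τ` of the squared bulk modulus and the relaxation time. -/

/-- `σ = ∫_{-1}^1 √(1-u²) du`. -/
def sigma : ℝ := ∫ u in (-1 : ℝ)..1, Real.sqrt (1 - u ^ 2)

/-- `m(u) / √(1-u²)`. -/
def scaledMobility (m : ℝ → ℝ) (u : ℝ) : ℝ := m u / Real.sqrt (1 - u ^ 2)

/-- `δ = 4 (∫_{-1}^1 m(u) / √(1-u²) du)⁻¹`. -/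
def delta (m : ℝ → ℝ) : ℝ := 4 * (∫ u in (-1 : ℝ)..1, m u / Real.sqrt (1 - u ^ 2))⁻¹

/-- `ω = ∫_{-1}^1 A²(u) τ(u) √(1-u²) du`. -/
def omega (B : ℝ → ℝ) : ℝ := ∫ u in (-1 : ℝ)..1, B u * Real.sqrt (1 - u ^ 2)

/-- The affine coupling function with slope `ε`. -/
def affineCoupling (ε u : ℝ) : ℝ := 1 + ε * u

/-- `(A² τ)⁻¹ (n² / n')² / √(1-u²)`. -/
def ellipticCoeff (B n : ℝ → ℝ) (u : ℝ) : ℝ :=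
  (B u)⁻¹ * (n u ^ 2 / deriv n u) ^ 2 / Real.sqrt (1 - u ^ 2)

/-! ### The constrained elliptic problem -/

/-- The constraint functional `C f (s) = ∫_{-1}^1 (f + (n/n') ∂_u f)(s, u) du` for smooth `f`. -/
def constraintFun {d : ℕ} (n : ℝ → ℝ) (f : Space d × ℝ → ℝ) (s : Space d) : ℝ :=
  ∫ u in (-1 : ℝ)..1, (f (s, u) + n u / deriv n u * deriv (fun v => f (s, v)) u)

/-- `L²(Γ × [-1,1]) × L²(Γ × [-1,1]; ℝ^d)`. -/
abbrev EnergyAmbient {d : ℕ} (Γ : Set (Space d)) : Type :=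
  WithLp 2 (Lp ℝ 2 (cylinderMeasure Γ) × Lp (Space d) 2 (cylinderMeasure Γ))

/-- The Hilbert space `H`: the completion of the space of all `f ∈ C^∞(Γ × [-1,1])` with
`√a ∂_u f ∈ L²` and `C f ∈ H¹(Γ)` for the inner product
`(f, g)_H = ∫_Γ ∫_{-1}^1 (a ∂_u f ∂_u g + m̂ ∇_Γ f · ∇_Γ g) du + (C f, C g)_{H¹(Γ)}`,
where `a = ellipticCoeff B n` and `m̂ = scaledMobility m`.
It is realised as the closure of the set of all triples `((√a ∂_u f, √m̂ ∇_Γ f), C f)`. -/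
def EnergySpace {d : ℕ} (Γ : Set (Space d)) (m B n : ℝ → ℝ) :
    Submodule ℝ (WithLp 2 (EnergyAmbient Γ × H1 Γ)) :=
  (Submodule.span ℝ {x : WithLp 2 (EnergyAmbient Γ × H1 Γ) |
    ∃ f : Space d × ℝ → ℝ, ContDiff ℝ ∞ f ∧
      x.fst.fst =ᵐ[cylinderMeasure Γ]
        (fun p => Real.sqrt (ellipticCoeff B n p.2) * deriv (fun v => f (p.1, v)) p.2) ∧
      x.fst.snd =ᵐ[cylinderMeasure Γ]
        (fun p => Real.sqrt (scaledMobility m p.2) •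
          surfaceGradient Γ (fun y => f (y, p.2)) p.1) ∧
      l2Part x.snd =ᵐ[surfaceMeasure Γ] constraintFun n f}).topologicalClosure

/-- The bilinear form `(f, g)_E = ∫_Γ ∫_{-1}^1 (a ∂_u f ∂_u g + m̂ ∇_Γ f · ∇_Γ g) du` on `H`. It is
the derivative at `f`, applied to `g`, of the energy `E(f) = (f, f)_E / 2`. -/
def energyForm {d : ℕ} {Γ : Set (Space d)} {m B n : ℝ → ℝ} (f g : EnergySpace Γ m B n) : ℝ :=
  inner ℝ (f : WithLp 2 (EnergyAmbient Γ × H1 Γ)).fst (g : WithLp 2 (EnergyAmbient Γ × H1 Γ)).fst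

/-- The constraint operator `C : H → H¹(Γ)`. -/
def constraint {d : ℕ} {Γ : Set (Space d)} {m B n : ℝ → ℝ} (f : EnergySpace Γ m B n) : H1 Γ :=
  (f : WithLp 2 (EnergyAmbient Γ × H1 Γ)).snd

/-- `(f, V) ∈ H × H¹(Γ)*` solves the constrained elliptic problem with datum `κ ∈ H¹(Γ)`:
`DE(f) = ⟨V, C ·⟩` in `H*` and `C f = σ κ` in `H¹(Γ)`. -/
def IsConstrainedSolution {d : ℕ} {Γ : Set (Space d)} {m B n : ℝ → ℝ} (κ : H1 Γ)
    (f : EnergySpace Γ m B n) (V : StrongDual ℝ (H1 Γ)) : Prop :=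
  (∀ φ : EnergySpace Γ m B n, energyForm f φ = V (constraint φ)) ∧ constraint f = sigma • κ

/-- `G` is the propagation operator `H¹(Γ) → H¹(Γ)*`, which maps `κ` to the Lagrange multiplier `V`
(the normal velocity) in the constrained elliptic problem with datum `κ`. -/
def IsPropagationOperator {d : ℕ} (Γ : Set (Space d)) (m B n : ℝ → ℝ)
    (G : H1 Γ →L[ℝ] StrongDual ℝ (H1 Γ)) : Prop :=
  ∀ κ : H1 Γ, ∃ f : EnergySpace Γ m B n, IsConstrainedSolution κ f (G κ)

/-- With `δ = del` and `ω = om`: `T = -σ (δ Id - ω Δ_Γ)⁻¹ Δ_Γ` on `H¹(Γ)`, that is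
`(δ Id - ω Δ_Γ) T κ = -σ Δ_Γ κ` weakly, for all `κ`. This is the operator of the intermediate surface diffusion flow `V_Γ = -σ (δ Id - ω Δ_Γ)⁻¹ Δ_Γ κ_Γ`. -/
def IsIntermediateSurfaceDiffusion {d : ℕ} (Γ : Set (Space d)) (del om : ℝ)
    (T : H1 Γ →L[ℝ] H1 Γ) : Prop :=
  ∀ κ ψ : H1 Γ,
    del * inner ℝ (l2Part (T κ)) (l2Part ψ) + om * inner ℝ (gradPart (T κ)) (gradPart ψ) =
      sigma * inner ℝ (gradPart κ) (gradPart ψ)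

end

end ViscoPhase

/-! The hypothesis `A² τ = n⁴ mt` makes the two coefficients reciprocal: with `W = mt √(1-u²)` one
has `m̂ = W` and `a = 1/(ε² W)` on `[-1,1]`. Moreover, `n' = ε` turns the integrand of the
constraint into the exact derivative of `n f / ε`, so the constraint sees only the values at `u =
±1`. On an eigenfunction `e` with eigenvalue `λ`, the ansatz `f = p(u) e(s)` therefore reduces the
elliptic problem to `p' = ε² W K`, `K' = λ W p`, `K(±1) = V n(±1)/ε`. In the variable `t = ∫ W` this
has constant coefficients and is solved by hyperbolic functions. Let `w = ∫ W`, so that `ω = w` and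
`δ = 4/w`, and let `x = ε √λ w/2`. The condition `C f = σ e` then gives `V = σ λ / D` with `D = w λ
(tanh x)/x + (4/w) x coth x = δ + ω λ + O(ε²)` for bounded `λ`
(`IsPropagationOperator.apply_eigenvector`, `symbolDenom_bounds`).

The multiplier exists by projecting a bounded right inverse of the constraint onto the orthogonal
complement of its kernel, and it is unique because a difference of solutions has zero energy
(`exists_lagrangeMultiplier`, `lagrangeMultiplier_unique`). Hence the explicit separated solution
computes the operator. `T` comes from Lax–Milgram and has symbol `σ λ / (δ + ω λ)`. Both operators
are diagonal and eigenspaces are `L²`-orthogonal, so the symbol estimate becomes the operator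
estimate.

The analytic work lies in the degenerate weight: `W` vanishes at `±1`, so `p` is only `C¹` and has
to be approximated by smooth profiles (`profileMap_mem`); the weak equation is checked on smooth
test functions by Fubini (`energyForm_separated`). -/

namespace ViscoPhase

/-! ### Finiteness of the surface measure -/

theorem finrank_ker_of_ne_zero {d : ℕ} {L : Space d →L[ℝ] ℝ} (hL : L ≠ 0) :
    Module.finrank ℝ (LinearMap.ker (L : Space d →ₗ[ℝ] ℝ)) = d - 1 := by
  have h1 : (L : Space d →ₗ[ℝ] ℝ) ≠ 0 := fun h => hL (by ext v; simpa using congr($h v))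
  have h2 := LinearMap.finrank_range_add_finrank_ker (L : Space d →ₗ[ℝ] ℝ)
  have h3 : LinearMap.range (L : Space d →ₗ[ℝ] ℝ) = ⊤ := LinearMap.range_eq_top.2
    (LinearMap.surjective h1)
  rw [h3, finrank_top, Module.finrank_self, finrank_euclideanSpace_fin] at h2
  omega

/-- A regular level set has locally finite Hausdorff measure of codimension one. -/
theorem exists_ball_hausdorffMeasure_lt_top {d : ℕ} {Φ : Space d → ℝ} {x : Space d}
    (hΦ : ContDiffAt ℝ ∞ Φ x) (hx : fderiv ℝ Φ x ≠ 0) {S : Set (Space d)}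
    (hS : ∀ y ∈ S, Φ y = 0) :
    ∃ r > 0, Measure.hausdorffMeasure (d - 1 : ℕ) (S ∩ Metric.ball x r) < ⊤ := by
  set L := fderiv ℝ Φ x with hLdef
  set N : Submodule ℝ (Space d) := LinearMap.ker (L : Space d →ₗ[ℝ] ℝ) with hN
  have hstrict : HasStrictFDerivAt Φ L x := hΦ.hasStrictFDerivAt (by simp)
  -- Tangential projection together with the normal derivative is injective, hence bounded below.
  let M : Space d →L[ℝ] N × ℝ := (N.orthogonalProjectionOnto).prod L
  have hMker : LinearMap.ker (M : Space d →ₗ[ℝ] N × ℝ) = ⊥ := by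
    rw [LinearMap.ker_eq_bot']
    intro v hv
    have h1 : N.orthogonalProjectionOnto v = 0 := congrArg Prod.fst hv
    have h2 : L v = 0 := congrArg Prod.snd hv
    have h3 : v ∈ N := h2
    have h4 := N.orthogonalProjectionOnto_mem_subspace_eq_self ⟨v, h3⟩
    rw [h1] at h4
    exact congrArg Subtype.val h4.symm
  obtain ⟨κ, hκ, hM⟩ := (M : Space d →ₗ[ℝ] N × ℝ).exists_antilipschitzWith hMker
  have hκ' : (0 : ℝ) < κ := hκ
  -- The slope `1/(2κ)` makes the `L`-component of a chord of the level set, multiplied by `κ`, at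
  -- most half its length, so the tangential component must dominate.
  obtain ⟨r, hr, hball⟩ : ∃ r > 0, ∀ y ∈ Metric.ball x r, ∀ z ∈ Metric.ball x r,
      ‖Φ y - Φ z - L (y - z)‖ ≤ 1 / (2 * κ) * ‖y - z‖ := by
    have h := hstrict.isLittleO.def (c := 1 / (2 * (κ : ℝ))) (by positivity)
    rw [nhds_prod_eq] at h
    obtain ⟨s, hs, hs'⟩ := (Filter.eventually_prod_self_iff
      (r := fun y z => ‖Φ y - Φ z - L (y - z)‖ ≤ 1 / (2 * κ) * ‖y - z‖)).1 h
    obtain ⟨r, hr, hrs⟩ := Metric.mem_nhds_iff.1 hs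
    exact ⟨r, hr, fun y hy z hz => hs' y (hrs hy) z (hrs hz)⟩
  refine ⟨r, hr, ?_⟩
  set A := S ∩ Metric.ball x r with hA
  -- The set is compared with its projection to the tangent hyperplane, a bounded set in dimension
  -- `d - 1`.
  let f : A → N := fun y => N.orthogonalProjectionOnto y
  have hf : AntilipschitzWith κ f := by
    refine AntilipschitzWith.of_le_mul_dist fun y z => ?_
    have h1 := hM.le_mul_dist (y : Space d) z
    have h2 := hball y y.2.2 z z.2.2
    rw [hS _ y.2.1, hS _ z.2.1, sub_self, zero_sub, norm_neg] at h2
    rw [Subtype.dist_eq]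
    have h3 : dist ((M : Space d →ₗ[ℝ] N × ℝ) y) ((M : Space d →ₗ[ℝ] N × ℝ) z) =
        max (dist (f y) (f z)) (dist (L y) (L z)) := rfl
    rw [h3] at h1
    have h4 : dist (L y) (L z) ≤ 1 / (2 * κ) * dist (y : Space d) z := by
      rw [dist_eq_norm, dist_eq_norm, ← map_sub]; exact h2
    have h5 : κ * (1 / (2 * κ) * dist (y : Space d) z) = dist (y : Space d) z / 2 := by
      field_simp
    rcases le_total (dist (f y) (f z)) (dist (L y) (L z)) with h | h
    · rw [max_eq_right h] at h1
      have h6 := mul_le_mul_of_nonneg_left h4 hκ'.le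
      have h7 : 0 ≤ (κ : ℝ) * dist (f y) (f z) := by positivity
      linarith
    · rwa [max_eq_left h] at h1
  have h1 := hf.le_hausdorffMeasure_image (d := (d - 1 : ℕ)) (by positivity) univ
  have h2 : Measure.hausdorffMeasure (d - 1 : ℕ) A =
      Measure.hausdorffMeasure (d - 1 : ℕ) (univ : Set A) := by
    have := (isometry_subtype_coe (s := A)).hausdorffMeasure_image
      (d := (d - 1 : ℕ)) (Or.inl (by positivity)) univ
    rwa [image_univ, Subtype.range_coe] at this
  rw [h2]
  refine h1.trans_lt (ENNReal.mul_lt_top (ENNReal.rpow_lt_top_of_nonneg (by positivity) (by simp)) ?_)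
  have hb : Bornology.IsBounded (f '' univ) := by
    have : f '' univ = N.orthogonalProjectionOnto '' A := by
      ext; simp [f]
    rw [this]
    exact (N.orthogonalProjectionOnto).lipschitz.isBounded_image
      (Metric.isBounded_ball.subset inter_subset_right)
  have hfin : Module.finrank ℝ N = d - 1 := finrank_ker_of_ne_zero hx
  have := hb.measure_lt_top (μ := Measure.hausdorffMeasure (Module.finrank ℝ N : ℕ))
  rwa [hfin] at this

theorem IsClosedHypersurface.isFiniteMeasure_surfaceMeasure {d : ℕ} {Γ : Set (Space d)}
    (hΓ : IsClosedHypersurface Γ) : IsFiniteMeasure (surfaceMeasure Γ) := by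
  have hfin : Measure.hausdorffMeasure (d - 1 : ℕ) Γ < ⊤ := by
    refine hΓ.isCompact.measure_lt_top_of_nhdsWithin fun x hx => ?_
    obtain ⟨U, Φ, hU, hxU, hΦ, hne, heq⟩ := hΓ.exists_local_equation x hx
    obtain ⟨r, hr, hlt⟩ := exists_ball_hausdorffMeasure_lt_top
      (hΦ.contDiffAt (hU.mem_nhds hxU)) (hne x hxU) (S := Γ ∩ U)
      (fun y hy => by rw [heq] at hy; exact hy.2)
    refine ⟨Γ ∩ U ∩ Metric.ball x r, ?_, hlt⟩
    rw [inter_assoc]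
    exact inter_mem_nhdsWithin _ (Filter.inter_mem (hU.mem_nhds hxU) (Metric.ball_mem_nhds x hr))
  refine ⟨?_⟩
  rw [surfaceMeasure, Measure.restrict_apply_univ, Measure.euclideanHausdorffMeasure_def,
    Measure.smul_apply]
  exact ENNReal.mul_lt_top (by simp) hfin


/-! ### Tensor products in `L²` and density in closed spans -/

noncomputable section

section Tensor

variable {α β F : Type*} [MeasurableSpace α] [MeasurableSpace β] {μ : Measure α} {ν : Measure β}
  [SFinite ν] [NormedAddCommGroup F] [NormedSpace ℝ F]

/-- Tonelli: the square of the norm of the integrand factorises. -/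
theorem eLpNorm_smul_prod {k : β → ℝ} {v : α → F} (hk : AEStronglyMeasurable k ν)
    (hv : AEStronglyMeasurable v μ) :
    eLpNorm (fun p : α × β => k p.2 • v p.1) 2 (μ.prod ν) = eLpNorm k 2 ν * eLpNorm v 2 μ := by
  have h2 : (2 : ENNReal) ≠ 0 := by norm_num
  have h2' : (2 : ENNReal) ≠ ⊤ := by norm_num
  simp only [eLpNorm_eq_lintegral_rpow_enorm_toReal h2 h2', enorm_smul]
  rw [← ENNReal.mul_rpow_of_nonneg _ _ (by positivity), mul_comm (∫⁻ _, _ ∂ν),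
    ← lintegral_prod_mul (hv.enorm.pow_const _) (hk.enorm.pow_const _)]
  congr 2
  ext p
  rw [ENNReal.mul_rpow_of_nonneg _ _ (by positivity), mul_comm]

theorem memLp_smul_prod {k : β → ℝ} {v : α → F} (hk : MemLp k 2 ν) (hv : MemLp v 2 μ) :
    MemLp (fun p : α × β => k p.2 • v p.1) 2 (μ.prod ν) := by
  refine ⟨(hk.1.comp_snd).smul (hv.1.comp_fst), ?_⟩
  rw [eLpNorm_smul_prod hk.1 hv.1]
  exact ENNReal.mul_lt_top hk.2 hv.2

/-- The tensor product `(s, u) ↦ k u • v s` of `L²`-functions. -/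
def tensorLp : Lp ℝ 2 ν →L[ℝ] Lp F 2 μ →L[ℝ] Lp F 2 (μ.prod ν) :=
  LinearMap.mkContinuous₂
    (LinearMap.mk₂ ℝ (fun k v => (memLp_smul_prod (Lp.memLp k) (Lp.memLp v)).toLp _)
      (fun k k' v => by
        rw [← MemLp.toLp_add, MemLp.toLp_eq_toLp_iff]
        filter_upwards [Measure.quasiMeasurePreserving_snd.ae (Lp.coeFn_add k k')] with p hp
        simp only [hp, Pi.add_apply, add_smul])
      (fun c k v => by
        rw [← MemLp.toLp_const_smul, MemLp.toLp_eq_toLp_iff]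
        filter_upwards [Measure.quasiMeasurePreserving_snd.ae (Lp.coeFn_smul c k)] with p hp
        simp only [hp, Pi.smul_apply, smul_assoc])
      (fun k v v' => by
        rw [← MemLp.toLp_add, MemLp.toLp_eq_toLp_iff]
        filter_upwards [Measure.quasiMeasurePreserving_fst.ae (Lp.coeFn_add v v')] with p hp
        simp only [hp, Pi.add_apply, smul_add])
      (fun c k v => by
        rw [← MemLp.toLp_const_smul, MemLp.toLp_eq_toLp_iff]
        filter_upwards [Measure.quasiMeasurePreserving_fst.ae (Lp.coeFn_smul c v)] with p hp
        simp only [hp, Pi.smul_apply, smul_comm c]))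
    1 (fun k v => by
      simp only [LinearMap.mk₂_apply]
      rw [Lp.norm_toLp, eLpNorm_smul_prod (Lp.aestronglyMeasurable k) (Lp.aestronglyMeasurable v),
        ENNReal.toReal_mul, one_mul, Lp.norm_def, Lp.norm_def])

theorem coeFn_tensorLp (k : Lp ℝ 2 ν) (v : Lp F 2 μ) :
    tensorLp k v =ᵐ[μ.prod ν] fun p => k p.2 • v p.1 :=
  MemLp.coeFn_toLp (memLp_smul_prod (Lp.memLp k) (Lp.memLp v))

theorem coeFn_tensorLp_toLp {k : β → ℝ} (hk : MemLp k 2 ν) {v : Lp F 2 μ} {v' : α → F}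
    (hv : v =ᵐ[μ] v') :
    tensorLp (hk.toLp k) v =ᵐ[μ.prod ν] fun p => k p.2 • v' p.1 := by
  filter_upwards [coeFn_tensorLp (hk.toLp k) v,
    Measure.quasiMeasurePreserving_snd.ae hk.coeFn_toLp,
    Measure.quasiMeasurePreserving_fst.ae hv] with p h1 h2 h3
  rw [h1, h2, h3]

end Tensor

/-- A closed subspace of the closed span of `s` which contains `s` is everything. -/
theorem mem_of_generators_mem {E : Type*} [NormedAddCommGroup E] [NormedSpace ℝ E] {s : Set E}
    {N : Submodule ℝ E} (hN : N = (Submodule.span ℝ s).topologicalClosure)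
    {S : Submodule ℝ N} (hS : IsClosed (S : Set N)) (h : ∀ x : N, (x : E) ∈ s → x ∈ S)
    (x : N) : x ∈ S := by
  have hNc : IsClosed (N : Set E) := by
    rw [hN]; exact (Submodule.span ℝ s).isClosed_topologicalClosure
  have hc : IsClosed ((S.map N.subtype : Submodule ℝ E) : Set E) := by
    rw [Submodule.map_coe]
    exact hNc.isClosedEmbedding_subtypeVal.isClosedMap _ hS
  have hsub : s ⊆ N := by
    rw [hN]; exact subset_trans Submodule.subset_span (Submodule.le_topologicalClosure _)
  have h1 : N ≤ S.map N.subtype := by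
    nth_rewrite 1 [hN]
    exact Submodule.topologicalClosure_minimal _
      (Submodule.span_le.2 fun y hy => ⟨⟨y, hsub hy⟩, h _ hy, rfl⟩) hc
  obtain ⟨y, hy, hyx⟩ := h1 x.2
  rwa [← Subtype.ext hyx]

end


/-! ### Separated functions with smooth profile -/

noncomputable section

/-- Lebesgue measure on `[-1,1]`. -/
abbrev intervalMeasure : Measure ℝ := volume.restrict (Icc (-1 : ℝ) 1)

/-- `W` is a continuous version of `m̂` for which `a = (ε² W)⁻¹`, where `a` and `m̂` are the
coefficients of the energy for the affine coupling with slope `ε`. -/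
structure IsWeight (m B : ℝ → ℝ) (ε : ℝ) (W : ℝ → ℝ) : Prop where
  continuous : Continuous W
  nonneg : ∀ u, 0 ≤ W u
  pos : ∀ u ∈ Ioo (-1 : ℝ) 1, 0 < W u
  integrable_inv : Integrable (fun u => (W u)⁻¹) intervalMeasure
  slope_pos : 0 < ε
  slope_lt_one : ε < 1
  ellipticCoeff_eq : ∀ u ∈ Icc (-1 : ℝ) 1,
    ellipticCoeff B (affineCoupling ε) u = (ε ^ 2 * W u)⁻¹
  scaledMobility_eq : ∀ u ∈ Icc (-1 : ℝ) 1, scaledMobility m u = W u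

theorem ae_intervalMeasure {P : ℝ → Prop} (h : ∀ u ∈ Icc (-1 : ℝ) 1, P u) :
    ∀ᵐ u ∂intervalMeasure, P u :=
  (ae_restrict_iff' measurableSet_Icc).2 (Filter.Eventually.of_forall h)

theorem ae_intervalMeasure_Ioo {P : ℝ → Prop} (h : ∀ u ∈ Ioo (-1 : ℝ) 1, P u) :
    ∀ᵐ u ∂intervalMeasure, P u := by
  rw [intervalMeasure, ← restrict_Ioo_eq_restrict_Icc]
  exact (ae_restrict_iff' measurableSet_Ioo).2 (Filter.Eventually.of_forall h)

theorem memLp_mul_of_continuous {k q : ℝ → ℝ} (hk : MemLp k 2 intervalMeasure)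
    (hq : Continuous q) : MemLp (fun u => k u * q u) 2 intervalMeasure := by
  obtain ⟨M, hM⟩ := isCompact_Icc.exists_bound_of_continuousOn (s := Icc (-1 : ℝ) 1)
    hq.continuousOn
  refine MemLp.of_le_mul (c := M) hk (hk.1.mul hq.aestronglyMeasurable)
    (ae_intervalMeasure fun u hu => ?_)
  rw [norm_mul, mul_comm]
  exact mul_le_mul_of_nonneg_right (hM u hu) (norm_nonneg _)

namespace IsWeight

variable {m B W : ℝ → ℝ} {ε : ℝ}

theorem memLp_sqrt_ellipticCoeff (hW : IsWeight m B ε W) :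
    MemLp (fun u => Real.sqrt (ellipticCoeff B (affineCoupling ε) u)) 2 intervalMeasure := by
  have h : MemLp (fun u => Real.sqrt ((ε ^ 2 * W u)⁻¹)) 2 intervalMeasure := by
    have hmeas : AEStronglyMeasurable (fun u => Real.sqrt ((ε ^ 2 * W u)⁻¹)) intervalMeasure :=
      (hW.continuous.measurable.const_mul _).inv.sqrt.aestronglyMeasurable
    rw [memLp_two_iff_integrable_sq hmeas]
    refine (hW.integrable_inv.const_mul (ε ^ 2)⁻¹).congr (Filter.Eventually.of_forall fun u => ?_)
    have := hW.nonneg u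
    simp only
    rw [Real.sq_sqrt (by positivity), mul_inv]
  exact h.ae_eq (ae_intervalMeasure fun u hu => by simp only [hW.ellipticCoeff_eq u hu])

theorem memLp_sqrt_scaledMobility (hW : IsWeight m B ε W) :
    MemLp (fun u => Real.sqrt (scaledMobility m u)) 2 intervalMeasure := by
  have h : MemLp (fun u => (1 : ℝ) * Real.sqrt (W u)) 2 intervalMeasure :=
    memLp_mul_of_continuous (memLp_const 1) hW.continuous.sqrt
  exact h.ae_eq (ae_intervalMeasure fun u hu => by simp only [hW.scaledMobility_eq u hu, one_mul])

end IsWeight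

theorem hasDerivAt_affineCoupling (ε u : ℝ) : HasDerivAt (affineCoupling ε) ε u := by
  unfold affineCoupling
  simpa using ((hasDerivAt_id u).const_mul ε).const_add 1

/-- For the affine coupling the constraint only involves boundary values. -/
theorem constraintFun_affineCoupling {d : ℕ} {ε : ℝ} (hε : ε ≠ 0) {f : Space d × ℝ → ℝ}
    (hf : ContDiff ℝ ∞ f) (s : Space d) :
    constraintFun (affineCoupling ε) f s =
      ε⁻¹ * ((1 + ε) * f (s, 1) - (1 - ε) * f (s, -1)) := by
  have hg : ContDiff ℝ ∞ fun v : ℝ => f (s, v) := by fun_prop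
  have hg' : Continuous (deriv fun v : ℝ => f (s, v)) := hg.continuous_deriv (by simp)
  have hn : Continuous (affineCoupling ε) := by unfold affineCoupling; fun_prop
  -- The integrand is the derivative of `n f / ε`, because `n' = ε`.
  have hd : ∀ u ∈ uIcc (-1 : ℝ) 1, HasDerivAt (fun u => ε⁻¹ * (affineCoupling ε u * f (s, u)))
      (f (s, u) + affineCoupling ε u / deriv (affineCoupling ε) u * deriv (fun v => f (s, v)) u)
      u := by
    intro u _
    have h1 := (hg.differentiable (by simp) u).hasDerivAt
    refine (((hasDerivAt_affineCoupling ε u).mul h1).const_mul ε⁻¹).congr_deriv ?_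
    rw [(hasDerivAt_affineCoupling ε u).deriv]
    field_simp
  rw [constraintFun, intervalIntegral.integral_eq_sub_of_hasDerivAt hd]
  · simp only [affineCoupling]; ring
  · refine Continuous.intervalIntegrable ?_ _ _
    simp only [fun u => (hasDerivAt_affineCoupling ε u).deriv]
    exact hg.continuous.add ((hn.div_const _).mul hg')

theorem surfaceGradient_mul_const {d : ℕ} (Γ : Set (Space d)) {h : Space d → ℝ}
    (hh : Differentiable ℝ h) (c : ℝ) (x : Space d) :
    surfaceGradient Γ (fun y => h y * c) x = c • surfaceGradient Γ h x := by
  rw [surfaceGradient, surfaceGradient, gradient, gradient, fderiv_mul_const (hh x), map_smul,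
    map_smul]

section Profile

variable {d : ℕ} {Γ : Set (Space d)}

/-- The map `H¹(Γ) → L²(Γ)`. -/
def l2PartL (Γ : Set (Space d)) : H1 Γ →L[ℝ] Lp ℝ 2 (surfaceMeasure Γ) :=
  (WithLp.fstL 2 ℝ _ _).comp (H1 Γ).subtypeL

/-- The surface gradient as a map `H¹(Γ) → L²(Γ; ℝ^d)`. -/
def gradPartL (Γ : Set (Space d)) : H1 Γ →L[ℝ] Lp (Space d) 2 (surfaceMeasure Γ) :=
  (WithLp.sndL 2 ℝ _ _).comp (H1 Γ).subtypeL

@[simp] theorem l2PartL_apply (e : H1 Γ) : l2PartL Γ e = l2Part e := rfl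

@[simp] theorem gradPartL_apply (e : H1 Γ) : gradPartL Γ e = gradPart e := rfl

/-- The tensor product of a function on `[-1,1]` and a function on `Γ`. -/
def cylTensor {F : Type*} [NormedAddCommGroup F] [NormedSpace ℝ F] :
    Lp ℝ 2 intervalMeasure →L[ℝ] Lp F 2 (surfaceMeasure Γ) →L[ℝ] Lp F 2 (cylinderMeasure Γ) :=
  tensorLp

theorem coeFn_cylTensor_toLp {F : Type*} [NormedAddCommGroup F] [NormedSpace ℝ F] {k : ℝ → ℝ}
    (hk : MemLp k 2 intervalMeasure) {v : Lp F 2 (surfaceMeasure Γ)} {v' : Space d → F}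
    (hv : v =ᵐ[surfaceMeasure Γ] v') :
    cylTensor (hk.toLp k) v =ᵐ[cylinderMeasure Γ] fun z => k z.2 • v' z.1 :=
  coeFn_tensorLp_toLp hk hv

/-- The map `e ↦ ((k₁ ⊗ e, k₂ ⊗ ∇_Γ e), c e)`. -/
def profileMap (k₁ k₂ : Lp ℝ 2 intervalMeasure) (c : ℝ) :
    H1 Γ →L[ℝ] WithLp 2 (EnergyAmbient Γ × H1 Γ) :=
  (WithLp.prodContinuousLinearEquiv 2 ℝ _ _).symm.toContinuousLinearMap.comp
    (((WithLp.prodContinuousLinearEquiv 2 ℝ (Lp ℝ 2 (cylinderMeasure Γ))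
        (Lp (Space d) 2 (cylinderMeasure Γ))).symm.toContinuousLinearMap.comp
      (((cylTensor k₁).comp (l2PartL Γ)).prod ((cylTensor k₂).comp (gradPartL Γ)))).prod
      (c • ContinuousLinearMap.id ℝ (H1 Γ)))

theorem profileMap_apply (k₁ k₂ : Lp ℝ 2 intervalMeasure) (c : ℝ) (e : H1 Γ) :
    profileMap k₁ k₂ c e =
      WithLp.toLp 2 (WithLp.toLp 2 (cylTensor k₁ (l2Part e), cylTensor k₂ (gradPart e)), c • e) :=
  rfl

theorem continuous_profileMap (e : H1 Γ) :
    Continuous fun k : Lp ℝ 2 intervalMeasure × Lp ℝ 2 intervalMeasure × ℝ =>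
      profileMap k.1 k.2.1 k.2.2 e := by
  simp only [profileMap_apply]
  fun_prop

/-- The value of the constraint on the function `p`. -/
def boundaryValue (ε : ℝ) (p : ℝ → ℝ) : ℝ := ε⁻¹ * ((1 + ε) * p 1 - (1 - ε) * p (-1))

variable {m B W : ℝ → ℝ} {ε : ℝ}

/-- For smooth `p` the function `p(u) e(s)` is in the energy space. -/
theorem profileMap_mem_of_contDiff (hε : ε ≠ 0) {p : ℝ → ℝ} (hp : ContDiff ℝ ∞ p)
    {k₁ k₂ : ℝ → ℝ} (hk₁ : MemLp k₁ 2 intervalMeasure) (hk₂ : MemLp k₂ 2 intervalMeasure)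
    (h₁ : ∀ u, k₁ u = Real.sqrt (ellipticCoeff B (affineCoupling ε) u) * deriv p u)
    (h₂ : ∀ u, k₂ u = Real.sqrt (scaledMobility m u) * p u) (e : H1 Γ) :
    profileMap (hk₁.toLp k₁) (hk₂.toLp k₂) (boundaryValue ε p) e ∈
      EnergySpace Γ m B (affineCoupling ε) := by
  -- For a fixed profile, membership is a closed linear condition on `e`, so it suffices to take for
  -- `e` the restriction of a smooth function.
  set N := EnergySpace Γ m B (affineCoupling ε) with hN
  set P := profileMap (Γ := Γ) (hk₁.toLp k₁) (hk₂.toLp k₂) (boundaryValue ε p)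
  refine mem_of_generators_mem (N := H1 Γ) rfl (S := N.comap (P : H1 Γ →ₗ[ℝ] _)) ?_ ?_ e
  · have hcl : IsClosed (N : Set (WithLp 2 (EnergyAmbient Γ × H1 Γ))) :=
      Submodule.isClosed_topologicalClosure _
    exact hcl.preimage P.continuous
  · rintro e ⟨h, hh, he₁, he₂⟩
    change P e ∈ N
    refine Submodule.le_topologicalClosure _ (Submodule.subset_span
      ⟨fun x => h x.1 * p x.2, by fun_prop, ?_, ?_, ?_⟩)
    · refine (coeFn_cylTensor_toLp hk₁ he₁).trans (Filter.Eventually.of_forall fun x => ?_)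
      simp only [h₁, smul_eq_mul, deriv_const_mul_field]
      ring
    · refine (coeFn_cylTensor_toLp hk₂ he₂).trans (Filter.Eventually.of_forall fun x => ?_)
      simp only [h₂, mul_smul]
      rw [surfaceGradient_mul_const Γ (hh.differentiable (by simp))]
    · have h1 : l2Part (P e).snd = boundaryValue ε p • l2Part e := rfl
      rw [h1]
      filter_upwards [Lp.coeFn_smul (boundaryValue ε p) (l2Part e), he₁] with s hs hs'
      have hs'' : l2Part e s = h s := hs'
      rw [hs, constraintFun_affineCoupling hε (by fun_prop), Pi.smul_apply, hs'', boundaryValue,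
        smul_eq_mul]
      ring

end Profile

end


/-! ### Separated functions with `C¹` profile -/

noncomputable section

theorem dist_toLp_mul_le {k q q' : ℝ → ℝ} (hk : MemLp k 2 intervalMeasure)
    (h : MemLp (fun u => k u * q u) 2 intervalMeasure)
    (h' : MemLp (fun u => k u * q' u) 2 intervalMeasure) {c : ℝ}
    (hc : ∀ u ∈ Icc (-1 : ℝ) 1, |q u - q' u| ≤ c) :
    dist (h.toLp _) (h'.toLp _) ≤ c * ‖hk.toLp k‖ := by
  rw [dist_eq_norm, ← MemLp.toLp_sub]
  refine Lp.norm_le_mul_norm_of_ae_le_mul ?_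
  filter_upwards [(h.sub h').coeFn_toLp, hk.coeFn_toLp, ae_intervalMeasure hc] with u h1 h2 h3
  rw [h1, h2, Pi.sub_apply, ← mul_sub, norm_mul, mul_comm, Real.norm_eq_abs (q u - q' u)]
  exact mul_le_mul_of_nonneg_right h3 (norm_nonneg _)

/-- A `C¹`-function is approximated in `C¹([-1,1])` by smooth functions. -/
theorem exists_smooth_near {p q : ℝ → ℝ} (hp : ∀ u, HasDerivAt p (q u) u) (hq : Continuous q)
    {η : ℝ} (hη : 0 < η) :
    ∃ p' : ℝ → ℝ, ContDiff ℝ ∞ p' ∧ (∀ u ∈ Icc (-1 : ℝ) 1, |q u - deriv p' u| ≤ η) ∧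
      ∀ u ∈ Icc (-1 : ℝ) 1, |p u - p' u| ≤ 2 * η := by
  obtain ⟨P, hP⟩ := exists_polynomial_near_of_continuousOn (-1) 1 q hq.continuousOn η hη
  -- The approximant is the primitive, with the correct value at `-1`, of a polynomial close to `q`;
  -- the interval has length 2, whence the error `2 * η`.
  have hd : ∀ u, HasDerivAt (fun u => p (-1) + ∫ v in (-1 : ℝ)..u, P.eval v) (P.eval u) u :=
    fun u => (intervalIntegral.integral_hasDerivAt_right
      (P.continuous.intervalIntegrable _ _) (P.continuous.stronglyMeasurableAtFilter _ _)
      P.continuous.continuousAt).const_add _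
  have hderiv : deriv (fun u => p (-1) + ∫ v in (-1 : ℝ)..u, P.eval v) = fun u => P.eval u :=
    funext fun u => (hd u).deriv
  have hb : ∀ u ∈ Icc (-1 : ℝ) 1, |q u - P.eval u| ≤ η := fun u hu => by
    rw [abs_sub_comm]; exact (hP u hu).le
  refine ⟨fun u => p (-1) + ∫ v in (-1 : ℝ)..u, P.eval v, ?_, ?_, fun u hu => ?_⟩
  · rw [contDiff_infty_iff_deriv, hderiv]
    exact ⟨fun u => (hd u).differentiableAt, by simpa using P.contDiff_aeval (𝕜 := ℝ) ∞⟩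
  · simpa only [hderiv] using hb
  · have h1 := (convex_Icc (-1 : ℝ) 1).norm_image_sub_le_of_norm_hasDerivWithin_le
      (f := fun u => p u - (p (-1) + ∫ v in (-1 : ℝ)..u, P.eval v)) (f' := fun u => q u - P.eval u)
      (C := η) (fun u _ => ((hp u).sub (hd u)).hasDerivWithinAt) hb
      (left_mem_Icc.2 (by norm_num)) hu
    simp only [intervalIntegral.integral_same, add_zero, sub_self, sub_zero, Real.norm_eq_abs] at h1
    have h2 : |u - -1| ≤ 2 := by rw [abs_le]; constructor <;> linarith [hu.1, hu.2]
    calc _ ≤ η * |u - -1| := h1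
      _ ≤ η * 2 := by gcongr
      _ = 2 * η := mul_comm _ _

variable {d : ℕ} {Γ : Set (Space d)} {m B W : ℝ → ℝ} {ε : ℝ}

/-- For `p ∈ C¹([-1,1])` the function `p(u) e(s)` is in the energy space. -/
theorem profileMap_mem (hW : IsWeight m B ε W) {p q : ℝ → ℝ} (hp : ∀ u, HasDerivAt p (q u) u)
    (hq : Continuous q)
    (hk₁ : MemLp (fun u => Real.sqrt (ellipticCoeff B (affineCoupling ε) u) * q u) 2
      intervalMeasure)
    (hk₂ : MemLp (fun u => Real.sqrt (scaledMobility m u) * p u) 2 intervalMeasure) (e : H1 Γ) :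
    profileMap (hk₁.toLp _) (hk₂.toLp _) (boundaryValue ε p) e ∈
      EnergySpace Γ m B (affineCoupling ε) := by
  set N := EnergySpace Γ m B (affineCoupling ε)
  have hcl : IsClosed (N : Set (WithLp 2 (EnergyAmbient Γ × H1 Γ))) :=
    Submodule.isClosed_topologicalClosure _
  -- Now `e` is fixed and membership is a closed condition on the profile data, so approximation in
  -- `L² × L² × ℝ` suffices.
  have hD := hcl.preimage (continuous_profileMap e)
  have hA := hW.memLp_sqrt_ellipticCoeff
  have hS := hW.memLp_sqrt_scaledMobility
  have hε := hW.slope_pos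
  have hε1 := hW.slope_lt_one
  have key : (hk₁.toLp _, hk₂.toLp _, boundaryValue ε p) ∈ closure
      ((fun k : Lp ℝ 2 intervalMeasure × Lp ℝ 2 intervalMeasure × ℝ =>
        profileMap k.1 k.2.1 k.2.2 e) ⁻¹' (N : Set _)) := by
    rw [Metric.mem_closure_iff]
    intro r hr
    -- `M` bounds all three errors per unit of `η`. Those of `p` at `±1` are at most `2 * η`, with
    -- factors `1 + ε` and `1 - ε`; 6 is a generous constant for their sum.
    set M := 1 + ‖hA.toLp _‖ + 2 * ‖hS.toLp _‖ + ε⁻¹ * 6 with hM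
    have hM0 : 0 < M := by positivity
    set η := r / (2 * M) with hη
    have hη0 : 0 < η := by positivity
    have hηM : η * M = r / 2 := by rw [hη]; field_simp
    obtain ⟨p', hp', h1, h2⟩ := exists_smooth_near hp hq hη0
    have hk₁' := memLp_mul_of_continuous hA (hp'.continuous_deriv (by simp))
    have hk₂' := memLp_mul_of_continuous hS hp'.continuous
    refine ⟨(hk₁'.toLp _, hk₂'.toLp _, boundaryValue ε p'),
      profileMap_mem_of_contDiff hε.ne' hp' hk₁' hk₂' (fun _ => rfl) (fun _ => rfl) e, ?_⟩
    have hle : ∀ x, x ≤ η * M → x < r := fun x hx => by rw [hηM] at hx; linarith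
    have hn1 : 0 ≤ ‖hA.toLp _‖ := norm_nonneg _
    have hn2 : 0 ≤ ‖hS.toLp _‖ := norm_nonneg _
    have hn3 : 0 < ε⁻¹ := by positivity
    rw [Prod.dist_eq, Prod.dist_eq, max_lt_iff, max_lt_iff]
    refine ⟨hle _ ((dist_toLp_mul_le hA hk₁ hk₁' h1).trans ?_),
      hle _ ((dist_toLp_mul_le hS hk₂ hk₂' h2).trans ?_), hle _ ?_⟩
    · refine mul_le_mul_of_nonneg_left ?_ hη0.le
      linarith
    · rw [mul_comm 2 η, mul_assoc]
      refine mul_le_mul_of_nonneg_left ?_ hη0.le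
      linarith
    · have h3 := h2 1 (right_mem_Icc.2 (by norm_num))
      have h4 := h2 (-1) (left_mem_Icc.2 (by norm_num))
      have h5 : boundaryValue ε p - boundaryValue ε p' =
          ε⁻¹ * ((1 + ε) * (p 1 - p' 1) - (1 - ε) * (p (-1) - p' (-1))) := by
        simp only [boundaryValue]; ring
      rw [Real.dist_eq, h5, abs_mul, abs_of_pos hn3]
      have h6 : |(1 + ε) * (p 1 - p' 1) - (1 - ε) * (p (-1) - p' (-1))| ≤ 6 * η := by
        rw [abs_le] at h3 h4 ⊢
        constructor <;> nlinarith
      calc _ ≤ ε⁻¹ * (6 * η) := by gcongr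
        _ = η * (ε⁻¹ * 6) := by ring
        _ ≤ η * M := by
          refine mul_le_mul_of_nonneg_left ?_ hη0.le
          linarith
  rw [hD.closure_eq] at key
  exact key

end


/-! ### The energy form tested with smooth functions -/

noncomputable section

variable {d : ℕ} {Γ : Set (Space d)}

theorem inner_real_eq_mul (x y : ℝ) : inner ℝ x y = x * y := by simp [mul_comm]

theorem norm_surfaceGradient_le (h : Space d → ℝ) (x : Space d) :
    ‖surfaceGradient Γ h x‖ ≤ ‖gradient h x‖ :=
  Submodule.norm_starProjection_apply_le _ _

theorem ae_surfaceMeasure (hΓ : IsCompact Γ) {P : Space d → Prop} (h : ∀ s ∈ Γ, P s) :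
    ∀ᵐ s ∂surfaceMeasure Γ, P s :=
  (ae_restrict_iff' hΓ.measurableSet).2 (Filter.Eventually.of_forall h)

theorem ae_cylinderMeasure (hΓ : IsCompact Γ) {P : Space d × ℝ → Prop}
    (h : ∀ s ∈ Γ, ∀ u ∈ Ioo (-1 : ℝ) 1, P (s, u)) : ∀ᵐ z ∂cylinderMeasure Γ, P z := by
  filter_upwards [Measure.quasiMeasurePreserving_fst.ae (ae_surfaceMeasure hΓ fun s hs => hs),
    Measure.quasiMeasurePreserving_snd.ae (ae_intervalMeasure_Ioo fun s hs => hs)] with z h1 h2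
  exact h _ h1 _ h2

variable {m B W : ℝ → ℝ} {ε : ℝ}

/-- The `∂_u`-part of the energy form of `p(u) e(s)` and a smooth function. -/
theorem inner_cylTensor_ellipticCoeff (hΓ : IsCompact Γ) (hW : IsWeight m B ε W)
    {K : ℝ → ℝ}
    (hk : MemLp (fun u => Real.sqrt (ellipticCoeff B (affineCoupling ε) u) * (ε ^ 2 * W u * K u)) 2
      intervalMeasure)
    {φ : Space d × ℝ → ℝ} (v : Lp ℝ 2 (surfaceMeasure Γ))
    {X : Lp ℝ 2 (cylinderMeasure Γ)}
    (hX : X =ᵐ[cylinderMeasure Γ] fun z =>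
      Real.sqrt (ellipticCoeff B (affineCoupling ε) z.2) * deriv (fun u => φ (z.1, u)) z.2) :
    inner ℝ (cylTensor (hk.toLp _) v : Lp ℝ 2 (cylinderMeasure Γ)) X =
      ∫ z, K z.2 * deriv (fun u => φ (z.1, u)) z.2 * v z.1 ∂cylinderMeasure Γ := by
  rw [L2.inner_def]
  refine integral_congr_ae ?_
  have h1 : (cylTensor (hk.toLp _) v : Lp ℝ 2 (cylinderMeasure Γ)) =ᵐ[cylinderMeasure Γ] _ :=
    coeFn_cylTensor_toLp hk (Filter.EventuallyEq.refl _ _)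
  filter_upwards [h1, hX, ae_cylinderMeasure (P := fun z => z.2 ∈ Ioo (-1 : ℝ) 1) hΓ
    fun s _ u hu => hu] with z hz1 hz2 hz3
  rw [hz1, hz2, inner_real_eq_mul, smul_eq_mul, hW.ellipticCoeff_eq _ (Ioo_subset_Icc_self hz3)]
  -- On the open interval `a` is exactly the inverse of `ε² W`, so only the flux `K` survives; the
  -- endpoints, where `W` may vanish, are null.
  have hWp := hW.pos _ hz3
  have hε := hW.slope_pos
  have hs : Real.sqrt ((ε ^ 2 * W z.2)⁻¹) * Real.sqrt ((ε ^ 2 * W z.2)⁻¹) = (ε ^ 2 * W z.2)⁻¹ :=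
    Real.mul_self_sqrt (by positivity)
  calc _ = (Real.sqrt ((ε ^ 2 * W z.2)⁻¹) * Real.sqrt ((ε ^ 2 * W z.2)⁻¹)) * (ε ^ 2 * W z.2) *
        (K z.2 * deriv (fun u => φ (z.1, u)) z.2 * v z.1) := by ring
    _ = _ := by rw [hs, inv_mul_cancel₀ (by positivity), one_mul]

variable [IsFiniteMeasure (surfaceMeasure Γ)]

/-- An eigenvector may be tested with every smooth function. -/
theorem IsEigenvector.integral_inner_surfaceGradient {lam : ℝ} {e : H1 Γ}
    (he : IsEigenvector lam e) (hΓ : IsCompact Γ) {h : Space d → ℝ} (hh : ContDiff ℝ ∞ h)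
    (hm : AEStronglyMeasurable (surfaceGradient Γ h) (surfaceMeasure Γ)) :
    ∫ s, inner ℝ (gradPart e s) (surfaceGradient Γ h s) ∂surfaceMeasure Γ =
      lam * ∫ s, l2Part e s * h s ∂surfaceMeasure Γ := by
  have hgrad : Continuous (gradient h) := by
    unfold gradient
    exact (LinearIsometryEquiv.continuous _).comp (hh.continuous_fderiv (by simp))
  obtain ⟨M₁, hM₁⟩ := hΓ.exists_bound_of_continuousOn hh.continuous.continuousOn
  obtain ⟨M₂, hM₂⟩ := hΓ.exists_bound_of_continuousOn hgrad.continuousOn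
  have h1 : MemLp h 2 (surfaceMeasure Γ) :=
    MemLp.of_bound hh.continuous.aestronglyMeasurable M₁ (ae_surfaceMeasure hΓ hM₁)
  have h2 : MemLp (surfaceGradient Γ h) 2 (surfaceMeasure Γ) :=
    MemLp.of_bound hm M₂ (ae_surfaceMeasure hΓ fun s hs =>
      (norm_surfaceGradient_le h s).trans (hM₂ s hs))
  -- The measurability hypothesis is what lets the pair `(h, ∇_Γ h)` define an element of `H¹(Γ)`.
  let ψ : H1 Γ := ⟨WithLp.toLp 2 (h1.toLp h, h2.toLp _),
    Submodule.le_topologicalClosure _ (Submodule.subset_span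
      ⟨h, hh, h1.coeFn_toLp, h2.coeFn_toLp⟩)⟩
  have key := he ψ
  rw [L2.inner_def, L2.inner_def] at key
  have e1 : ∀ᵐ s ∂surfaceMeasure Γ, gradPart ψ s = surfaceGradient Γ h s := h2.coeFn_toLp
  have e2 : ∀ᵐ s ∂surfaceMeasure Γ, l2Part ψ s = h s := h1.coeFn_toLp
  rw [integral_congr_ae (g := fun s => inner ℝ (gradPart e s) (surfaceGradient Γ h s))
    (by filter_upwards [e1] with s hs; rw [hs]),
    integral_congr_ae (f := fun s => inner ℝ (l2Part e s) (l2Part ψ s))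
      (g := fun s => l2Part e s * h s)
      (by filter_upwards [e2] with s hs; rw [hs, inner_real_eq_mul, mul_comm])] at key
  exact key

/-- Integration against a continuous function over the cylinder. -/
theorem integrable_continuous_mul (hΓ : IsCompact Γ) {g : Space d × ℝ → ℝ} (hg : Continuous g)
    (v : Lp ℝ 2 (surfaceMeasure Γ)) : Integrable (fun z => g z * v z.1) (cylinderMeasure Γ) := by
  obtain ⟨M, hM⟩ := (hΓ.prod (isCompact_Icc (a := (-1 : ℝ)) (b := 1))).exists_bound_of_continuousOn
    hg.continuousOn
  have hv : Integrable v (surfaceMeasure Γ) := (Lp.memLp v).integrable (by norm_num)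
  have hv' : Integrable (fun z : Space d × ℝ => v z.1) (cylinderMeasure Γ) := hv.comp_fst _
  exact hv'.bdd_mul hg.aestronglyMeasurable (ae_cylinderMeasure hΓ fun s hs u hu =>
    hM (s, u) ⟨hs, Ioo_subset_Icc_self hu⟩)

/-- Measurability is inherited from the `L²`-representative `X`: almost every slice of it is
measurable, and the factor `√m̂` is nonzero inside the interval. -/
theorem ae_aestronglyMeasurable_surfaceGradient (hW : IsWeight m B ε W)
    {φ : Space d × ℝ → ℝ} {X : Lp (Space d) 2 (cylinderMeasure Γ)}
    (hX : X =ᵐ[cylinderMeasure Γ] fun z => Real.sqrt (scaledMobility m z.2) •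
      surfaceGradient Γ (fun y => φ (y, z.2)) z.1) :
    ∀ᵐ u ∂intervalMeasure,
      AEStronglyMeasurable (surfaceGradient Γ fun y => φ (y, u)) (surfaceMeasure Γ) := by
  have h1 := ((Lp.aestronglyMeasurable X).congr hX).prod_swap.prodMk_left
  filter_upwards [h1, ae_intervalMeasure_Ioo fun u hu => hu] with u hu hu'
  have hpos : Real.sqrt (scaledMobility m u) ≠ 0 := by
    rw [hW.scaledMobility_eq u (Ioo_subset_Icc_self hu')]
    exact (Real.sqrt_pos.2 (hW.pos u hu')).ne'
  refine (hu.const_smul (Real.sqrt (scaledMobility m u))⁻¹).congr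
    (Filter.Eventually.of_forall fun s => ?_)
  simp only [Pi.smul_apply, Prod.swap_prod_mk]
  rw [inv_smul_smul₀ hpos]

/-- The tangential part of the energy form of `p(u) e(s)` and a smooth function. -/
theorem inner_cylTensor_scaledMobility (hΓ : IsCompact Γ) (hW : IsWeight m B ε W)
    {p : ℝ → ℝ} (hp : Continuous p)
    (hk : MemLp (fun u => Real.sqrt (scaledMobility m u) * p u) 2 intervalMeasure)
    {φ : Space d × ℝ → ℝ} (hφ : ContDiff ℝ ∞ φ) {lam : ℝ} {e : H1 Γ} (he : IsEigenvector lam e)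
    {X : Lp (Space d) 2 (cylinderMeasure Γ)}
    (hX : X =ᵐ[cylinderMeasure Γ] fun z => Real.sqrt (scaledMobility m z.2) •
      surfaceGradient Γ (fun y => φ (y, z.2)) z.1) :
    inner ℝ (cylTensor (hk.toLp _) (gradPart e) : Lp (Space d) 2 (cylinderMeasure Γ)) X =
      ∫ z, lam * W z.2 * p z.2 * φ z * l2Part e z.1 ∂cylinderMeasure Γ := by
  set Y : Lp (Space d) 2 (cylinderMeasure Γ) := cylTensor (hk.toLp _) (gradPart e) with hY
  have h1 : Y =ᵐ[cylinderMeasure Γ] _ :=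
    coeFn_cylTensor_toLp hk (Filter.EventuallyEq.refl _ _)
  have h2 : (fun z => inner ℝ (Y z) (X z)) =ᵐ[cylinderMeasure Γ] fun z =>
      W z.2 * p z.2 * inner ℝ (gradPart e z.1) (surfaceGradient Γ (fun y => φ (y, z.2)) z.1) := by
    filter_upwards [h1, hX, ae_cylinderMeasure (P := fun z => z.2 ∈ Ioo (-1 : ℝ) 1) hΓ
      fun s _ u hu => hu] with z hz1 hz2 hz3
    rw [hz1, hz2, real_inner_smul_left, real_inner_smul_right,
      hW.scaledMobility_eq _ (Ioo_subset_Icc_self hz3)]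
    have hs := Real.mul_self_sqrt (hW.nonneg z.2)
    linear_combination (p z.2 * inner ℝ (gradPart e z.1)
      (surfaceGradient Γ (fun y => φ (y, z.2)) z.1)) * hs
  have hint := (L2.integrable_inner Y X (𝕜 := ℝ)).congr h2
  have hint' : Integrable (fun z => lam * W z.2 * p z.2 * φ z * l2Part e z.1)
      (cylinderMeasure Γ) := by
    have hWc := hW.continuous
    exact integrable_continuous_mul hΓ (g := fun z => lam * W z.2 * p z.2 * φ z) (by fun_prop) _
  rw [L2.inner_def, integral_congr_ae h2]
  unfold cylinderMeasure at hint hint' ⊢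
  -- Integrating over `Γ` first allows the eigenvalue equation to be applied on each slice `u =
  -- const`.
  rw [integral_prod_symm _ hint, integral_prod_symm _ hint']
  refine integral_congr_ae ?_
  filter_upwards [ae_aestronglyMeasurable_surfaceGradient hW hX] with u hu
  rw [integral_const_mul, he.integral_inner_surfaceGradient hΓ (by fun_prop) hu,
    ← integral_const_mul, ← integral_const_mul]
  exact integral_congr_ae (Filter.Eventually.of_forall fun s => by ring)

end


/-! ### Lagrange multipliers and the constrained problem -/

noncomputable section


section Hilbert

variable {E K : Type*} [NormedAddCommGroup E] [InnerProductSpace ℝ E] [NormedAddCommGroup K]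
  [InnerProductSpace ℝ K]

/-- A variational identity on a closed span may be tested on generators. -/
theorem inner_fst_eq_of_generators {s : Set (WithLp 2 (E × K))}
    {N : Submodule ℝ (WithLp 2 (E × K))} (hN : N = (Submodule.span ℝ s).topologicalClosure)
    {g : E} {l : StrongDual ℝ K} (h : ∀ x ∈ s, inner ℝ g x.fst = l x.snd) (x : N) :
    inner ℝ g (x : WithLp 2 (E × K)).fst = l (x : WithLp 2 (E × K)).snd := by
  let T : N →L[ℝ] ℝ := ((innerSL ℝ g).comp (WithLp.fstL 2 ℝ E K) -
    l.comp (WithLp.sndL 2 ℝ E K)).comp N.subtypeL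
  have hx : x ∈ LinearMap.ker (T : N →ₗ[ℝ] ℝ) :=
    mem_of_generators_mem hN T.isClosed_ker (fun y hy => sub_eq_zero.2 (h _ hy)) x
  exact sub_eq_zero.1 hx

variable {N : Submodule ℝ (WithLp 2 (E × K))}

/-- The Lagrange multiplier of a constrained quadratic problem is unique. -/
theorem lagrangeMultiplier_unique
    (hJ : ∀ κ : K, ∃ f : N, (f : WithLp 2 (E × K)).snd = κ) {κ : K} {f f' : N}
    {V V' : StrongDual ℝ K}
    (h : ∀ φ : N, inner ℝ (f : WithLp 2 (E × K)).fst (φ : WithLp 2 (E × K)).fst =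
      V (φ : WithLp 2 (E × K)).snd)
    (h' : ∀ φ : N, inner ℝ (f' : WithLp 2 (E × K)).fst (φ : WithLp 2 (E × K)).fst =
      V' (φ : WithLp 2 (E × K)).snd)
    (hf : (f : WithLp 2 (E × K)).snd = κ) (hf' : (f' : WithLp 2 (E × K)).snd = κ) : V = V' := by
  have hE : ∀ φ : N, inner ℝ ((f : WithLp 2 (E × K)).fst - (f' : WithLp 2 (E × K)).fst)
      (φ : WithLp 2 (E × K)).fst =
      V (φ : WithLp 2 (E × K)).snd - V' (φ : WithLp 2 (E × K)).snd := fun φ => by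
    rw [inner_sub_left, h, h']
  -- The difference has zero constraint, so testing with itself shows that its energy part vanishes;
  -- surjectivity of the constraint then identifies the multipliers.
  have h0 := hE (f - f')
  simp only [Submodule.coe_sub, WithLp.sub_fst, WithLp.sub_snd, hf, hf', sub_self, map_zero,
    inner_self_eq_zero] at h0
  ext ψ
  obtain ⟨φ, hφ⟩ := hJ ψ
  have h1 := hE φ
  rw [h0, inner_zero_left, hφ] at h1
  linarith

/-- A constrained quadratic problem whose constraint has a bounded right inverse is solvable, and
the Lagrange multiplier depends continuously on the datum. -/
theorem exists_lagrangeMultiplier [CompleteSpace E] [CompleteSpace K]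
    (hN : IsClosed (N : Set (WithLp 2 (E × K)))) (J : K →L[ℝ] N)
    (hJ : ∀ κ, (J κ : WithLp 2 (E × K)).snd = κ) (σ : ℝ) :
    ∃ G : K →L[ℝ] StrongDual ℝ K, ∀ κ, ∃ f : N,
      (∀ φ : N, inner ℝ (f : WithLp 2 (E × K)).fst (φ : WithLp 2 (E × K)).fst =
        G κ (φ : WithLp 2 (E × K)).snd) ∧ (f : WithLp 2 (E × K)).snd = σ • κ := by
  have : CompleteSpace N := hN.completeSpace_coe
  let C : N →L[ℝ] K := (WithLp.sndL 2 ℝ E K).comp N.subtypeL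
  set Z := LinearMap.ker (C : N →ₗ[ℝ] K) with hZ
  have : CompleteSpace Z := C.isClosed_ker.completeSpace_coe
  -- Removing the component of `J` in the kernel of the constraint keeps it a right inverse and
  -- makes its range orthogonal to that kernel.
  let S : K →L[ℝ] N := (Zᗮ.starProjection).comp J
  have hSmem : ∀ κ, S κ ∈ Zᗮ := fun κ => Submodule.starProjection_apply_mem _ _
  have hCS : ∀ κ, C (S κ) = κ := fun κ => by
    have h1 : J κ - S κ ∈ Z := by
      have := Submodule.sub_starProjection_mem_orthogonal (K := Zᗮ) (J κ)
      rwa [Submodule.orthogonal_orthogonal] at this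
    have h2 : C (J κ - S κ) = 0 := h1
    have h3 : C (J κ) = κ := hJ κ
    rw [map_sub, h3, sub_eq_zero] at h2
    exact h2.symm
  -- Orthogonality gives `(S κ, φ) = (S κ, S C φ)` in the full inner product; subtracting the
  -- constraint part `(κ, C φ)` leaves the energy form.
  let G : K →L[ℝ] StrongDual ℝ K := σ • (((innerSL ℝ).bilinearComp S S) - innerSL ℝ)
  refine ⟨G, fun κ => ⟨σ • S κ, fun φ => ?_, congrArg (σ • ·) (hCS κ)⟩⟩
  have h1 : φ - S (C φ) ∈ Z := by
    change C (φ - S (C φ)) = 0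
    rw [map_sub, hCS, sub_self]
  have h2 : inner ℝ (S κ) (φ - S (C φ)) = 0 :=
    Submodule.inner_left_of_mem_orthogonal h1 (hSmem κ)
  have h3 : inner ℝ (S κ) φ = inner ℝ (S κ : WithLp 2 (E × K)).fst (φ : WithLp 2 (E × K)).fst +
    inner ℝ (C (S κ)) (C φ) := rfl
  have h4 : G κ (C φ) = σ * (inner ℝ (S κ) (S (C φ)) - inner ℝ κ (C φ)) := rfl
  rw [inner_sub_right, sub_eq_zero, h3, hCS] at h2
  change _ = G κ (C φ)
  rw [h4, ← h2, Submodule.coe_smul, WithLp.smul_fst, real_inner_smul_left]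
  ring

end Hilbert

variable {d : ℕ} {Γ : Set (Space d)} {m B W : ℝ → ℝ} {ε : ℝ}

/-- The separated function `p(u) e(s)` as an element of the energy space. -/
def separated (hW : IsWeight m B ε W) {p q : ℝ → ℝ} (hp : ∀ u, HasDerivAt p (q u) u)
    (hq : Continuous q) (e : H1 Γ) : EnergySpace Γ m B (affineCoupling ε) :=
  ⟨_, profileMap_mem hW hp hq (memLp_mul_of_continuous hW.memLp_sqrt_ellipticCoeff hq)
    (memLp_mul_of_continuous hW.memLp_sqrt_scaledMobility
      (continuous_iff_continuousAt.2 fun u => (hp u).continuousAt)) e⟩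

theorem constraint_separated (hW : IsWeight m B ε W) {p q : ℝ → ℝ}
    (hp : ∀ u, HasDerivAt p (q u) u) (hq : Continuous q) (e : H1 Γ) :
    constraint (separated hW hp hq e) = boundaryValue ε p • e :=
  rfl

/-- The functional `ψ ↦ (e, ψ)_{L²(Γ)}`. -/
def l2Functional (e : H1 Γ) : StrongDual ℝ (H1 Γ) := (innerSL ℝ (l2Part e)).comp (l2PartL Γ)

theorem l2Functional_apply (e ψ : H1 Γ) :
    l2Functional e ψ = inner ℝ (l2Part e) (l2Part ψ) := rfl

/-- A right inverse of the constraint operator. -/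
def constraintRightInv (Γ : Set (Space d)) (hW : IsWeight m B ε W) :
    H1 Γ →L[ℝ] EnergySpace Γ m B (affineCoupling ε) :=
  (profileMap
    ((memLp_mul_of_continuous hW.memLp_sqrt_ellipticCoeff (continuous_const (y := (0 : ℝ)))).toLp _)
    ((memLp_mul_of_continuous hW.memLp_sqrt_scaledMobility
      (continuous_const (y := (1 / 2 : ℝ)))).toLp _)
    (boundaryValue ε fun _ => 1 / 2)).codRestrict _
    (profileMap_mem hW (fun _ => hasDerivAt_const _ _) continuous_const _ _)

theorem constraint_constraintRightInv (hW : IsWeight m B ε W) (h : H1 Γ) :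
    constraint (constraintRightInv Γ hW h) = h := by
  -- Functions constant in `u` have constraint twice their value, since `n(1) - n(-1) = 2 ε`.
  have h1 : boundaryValue ε (fun _ => 1 / 2) = 1 := by
    have := hW.slope_pos.ne'
    simp only [boundaryValue]
    field_simp
    ring
  change boundaryValue ε (fun _ => 1 / 2) • h = h
  rw [h1, one_smul]

/-- The datum determines the Lagrange multiplier. -/
theorem IsConstrainedSolution.multiplier_unique (hW : IsWeight m B ε W) {κ : H1 Γ}
    {f f' : EnergySpace Γ m B (affineCoupling ε)} {V V' : StrongDual ℝ (H1 Γ)}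
    (h : IsConstrainedSolution κ f V) (h' : IsConstrainedSolution κ f' V') : V = V' :=
  lagrangeMultiplier_unique (fun κ => ⟨_, constraint_constraintRightInv hW κ⟩)
    h.1 h'.1 h.2 h'.2

instance : CompleteSpace (H1 Γ) := (Submodule.isClosed_topologicalClosure _).completeSpace_coe

theorem existsUnique_isPropagationOperator (hW : IsWeight m B ε W) :
    ∃! G : H1 Γ →L[ℝ] StrongDual ℝ (H1 Γ),
      IsPropagationOperator Γ m B (affineCoupling ε) G := by
  obtain ⟨G, hG⟩ := exists_lagrangeMultiplier (N := EnergySpace Γ m B (affineCoupling ε))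
    (Submodule.isClosed_topologicalClosure _) (constraintRightInv Γ hW)
    (constraint_constraintRightInv hW) sigma
  refine ⟨G, hG, fun G' hG' => ?_⟩
  ext1 κ
  obtain ⟨f, hf⟩ := hG' κ
  obtain ⟨f', hf'⟩ := hG κ
  exact hf.multiplier_unique hW hf'

variable [IsFiniteMeasure (surfaceMeasure Γ)]

/-- `K = a p'` is the flux. On each fibre the integrand is `K φ' + K' φ = (K φ)'`, and the boundary
values of `K` are proportional to `n(±1)`, so the boundary terms reproduce `V` times the constraint
of `φ`. -/
theorem energyForm_separated (hΓ : IsCompact Γ) (hW : IsWeight m B ε W) {p K : ℝ → ℝ} {lam V : ℝ}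
    (hp : ∀ u, HasDerivAt p (ε ^ 2 * W u * K u) u) (hq : Continuous fun u => ε ^ 2 * W u * K u)
    (hK : ∀ u, HasDerivAt K (lam * W u * p u) u)
    (h1 : K 1 = V * (ε⁻¹ * (1 + ε))) (h2 : K (-1) = V * (ε⁻¹ * (1 - ε)))
    {e : H1 Γ} (he : IsEigenvector lam e) (x : EnergySpace Γ m B (affineCoupling ε)) :
    energyForm (separated hW hp hq e) x = V * l2Functional e (constraint x) := by
  refine inner_fst_eq_of_generators (N := EnergySpace Γ m B (affineCoupling ε))
    (l := V • l2Functional e) rfl ?_ x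
  rintro x ⟨φ, hφ, hx₁, hx₂, hx₃⟩
  have hpc : Continuous p := continuous_iff_continuousAt.2 fun u => (hp u).continuousAt
  have hKc : Continuous K := continuous_iff_continuousAt.2 fun u => (hK u).continuousAt
  have hWc := hW.continuous
  have hsum : inner ℝ (separated hW hp hq e : WithLp 2 (EnergyAmbient Γ × H1 Γ)).fst x.fst =
      _ + _ := congrArg₂ (· + ·)
    (inner_cylTensor_ellipticCoeff hΓ hW
      (memLp_mul_of_continuous hW.memLp_sqrt_ellipticCoeff hq) (l2Part e) hx₁)
    (inner_cylTensor_scaledMobility hΓ hW hpc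
      (memLp_mul_of_continuous hW.memLp_sqrt_scaledMobility hpc) hφ he hx₂)
  have hφs : ∀ s, ContDiff ℝ ∞ fun u : ℝ => φ (s, u) := fun s => by fun_prop
  have hφd : ∀ z : Space d × ℝ, deriv (fun u => φ (z.1, u)) z.2 = fderiv ℝ φ z (0, 1) := by
    intro z
    have h1 : HasDerivAt (fun u : ℝ => (z.1, u)) ((0 : Space d), (1 : ℝ)) z.2 :=
      (hasDerivAt_const _ _).prodMk (hasDerivAt_id _)
    exact ((hφ.differentiable (by simp) z).hasFDerivAt.comp_hasDerivAt z.2 h1).deriv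
  have hφc : Continuous fun z : Space d × ℝ => deriv (fun u => φ (z.1, u)) z.2 := by
    simp only [hφd]
    exact (hφ.continuous_fderiv (by simp)).clm_apply continuous_const
  have hφ0 := hφ.continuous
  have i1 := integrable_continuous_mul hΓ
    (g := fun z => K z.2 * deriv (fun u => φ (z.1, u)) z.2) (by fun_prop) (l2Part e)
  have i2 := integrable_continuous_mul hΓ (g := fun z => lam * W z.2 * p z.2 * φ z)
    (by fun_prop) (l2Part e)
  rw [hsum, ← integral_add i1 i2]
  unfold cylinderMeasure at i1 i2 ⊢
  refine (integral_prod _ (i1.add i2)).trans ?_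
  simp only [Pi.add_apply]
  have hinner : ∀ s, ∫ u, (K u * deriv (fun u => φ (s, u)) u * l2Part e s +
      lam * W u * p u * φ (s, u) * l2Part e s) ∂intervalMeasure =
      V * (l2Part e s * constraintFun (affineCoupling ε) φ s) := by
    intro s
    have hc : Continuous fun u => lam * W u * p u * φ (s, u) +
        K u * deriv (fun u => φ (s, u)) u := by
      have := (hφs s).continuous_deriv (by simp)
      have := (hφs s).continuous
      fun_prop
    calc _ = ∫ u, (lam * W u * p u * φ (s, u) + K u * deriv (fun u => φ (s, u)) u) * l2Part e s
          ∂intervalMeasure := by congr 1; ext u; ring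
      _ = (∫ u in (-1 : ℝ)..1, lam * W u * p u * φ (s, u) + K u * deriv (fun u => φ (s, u)) u) *
          l2Part e s := by
        rw [integral_mul_const, intervalIntegral.integral_of_le (by norm_num),
          integral_Icc_eq_integral_Ioc]
      _ = (K 1 * φ (s, 1) - K (-1) * φ (s, -1)) * l2Part e s := by
        rw [intervalIntegral.integral_eq_sub_of_hasDerivAt (f := fun u => K u * φ (s, u))
          (fun u _ => (hK u).mul ((hφs s).differentiable (by simp) u).hasDerivAt)
          (hc.intervalIntegrable _ _)]
      _ = _ := by
        rw [h1, h2, constraintFun_affineCoupling hW.slope_pos.ne' hφ]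
        ring
  simp only [hinner]
  rw [integral_const_mul]
  change _ = V * inner ℝ (l2Part e) (l2Part x.snd)
  rw [L2.inner_def]
  congr 1
  refine integral_congr_ae ?_
  filter_upwards [hx₃] with s hs
  have hs' : l2Part x.snd s = constraintFun (affineCoupling ε) φ s := hs
  rw [inner_real_eq_mul, hs']

/-- A separated solution of the constrained elliptic problem. -/
theorem isConstrainedSolution_separated (hΓ : IsCompact Γ) (hW : IsWeight m B ε W) {p K : ℝ → ℝ}
    {lam V : ℝ}
    (hp : ∀ u, HasDerivAt p (ε ^ 2 * W u * K u) u) (hq : Continuous fun u => ε ^ 2 * W u * K u)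
    (hK : ∀ u, HasDerivAt K (lam * W u * p u) u)
    (h1 : K 1 = V * (ε⁻¹ * (1 + ε))) (h2 : K (-1) = V * (ε⁻¹ * (1 - ε)))
    (h3 : boundaryValue ε p = sigma)
    {e : H1 Γ} (he : IsEigenvector lam e) :
    IsConstrainedSolution e (separated hW hp hq e) (V • l2Functional e) :=
  ⟨fun x => energyForm_separated hΓ hW hp hq hK h1 h2 he x, by rw [constraint_separated, h3]⟩

end


/-! ### Intermediate surface diffusion and eigenspaces -/

noncomputable section

section Coercive

variable {V E F : Type*} [NormedAddCommGroup V] [InnerProductSpace ℝ V] [CompleteSpace V]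
  [NormedAddCommGroup E] [InnerProductSpace ℝ E] [NormedAddCommGroup F] [InnerProductSpace ℝ F]
  {P : V →L[ℝ] E} {Q : V →L[ℝ] F}

omit [CompleteSpace V] in
theorem eq_of_weighted_inner_eq
    (hPQ : ∀ v w, inner ℝ v w = inner ℝ (P v) (P w) + inner ℝ (Q v) (Q w))
    {a b : ℝ} (ha : 0 < a) (hb : 0 < b) {v w : V}
    (h : ∀ ψ, a * inner ℝ (P v) (P ψ) + b * inner ℝ (Q v) (Q ψ) =
      a * inner ℝ (P w) (P ψ) + b * inner ℝ (Q w) (Q ψ)) : v = w := by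
  have h1 := h (v - w)
  have h2 : a * inner ℝ (P (v - w)) (P (v - w)) + b * inner ℝ (Q (v - w)) (Q (v - w)) = 0 := by
    rw [map_sub P v w, map_sub Q v w, inner_sub_left, inner_sub_left (Q v), ← map_sub, ← map_sub]
    linarith
  have h3 : 0 ≤ inner ℝ (P (v - w)) (P (v - w)) := real_inner_self_nonneg
  have h4 : 0 ≤ inner ℝ (Q (v - w)) (Q (v - w)) := real_inner_self_nonneg
  have h5 := mul_nonneg ha.le h3
  have h6 := mul_nonneg hb.le h4
  have h7 : inner ℝ (P (v - w)) (P (v - w)) = 0 :=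
    (mul_eq_zero.1 (by linarith : a * _ = 0)).resolve_left ha.ne'
  have h8 : inner ℝ (Q (v - w)) (Q (v - w)) = 0 :=
    (mul_eq_zero.1 (by linarith : b * _ = 0)).resolve_left hb.ne'
  rw [← sub_eq_zero, ← inner_self_eq_zero (𝕜 := ℝ), hPQ, h7, h8, add_zero]

/-- Lax–Milgram: the weighted form is coercive with constant `min a b`. -/
theorem existsUnique_weighted_inner_eq
    (hPQ : ∀ v w, inner ℝ v w = inner ℝ (P v) (P w) + inner ℝ (Q v) (Q w))
    {a b : ℝ} (ha : 0 < a) (hb : 0 < b) (c : ℝ) :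
    ∃! T : V →L[ℝ] V, ∀ κ ψ, a * inner ℝ (P (T κ)) (P ψ) + b * inner ℝ (Q (T κ)) (Q ψ) =
      c * inner ℝ (Q κ) (Q ψ) := by
  let β : V →L[ℝ] V →L[ℝ] ℝ :=
    a • (innerSL ℝ).bilinearComp P P + b • (innerSL ℝ).bilinearComp Q Q
  have hβ : ∀ v w, β v w = a * inner ℝ (P v) (P w) + b * inner ℝ (Q v) (Q w) := fun _ _ => rfl
  have hco : IsCoercive β := by
    refine ⟨min a b, lt_min ha hb, fun u => ?_⟩
    have h3 : 0 ≤ inner ℝ (P u) (P u) := real_inner_self_nonneg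
    have h4 : 0 ≤ inner ℝ (Q u) (Q u) := real_inner_self_nonneg
    rw [hβ, mul_assoc, ← real_inner_self_eq_norm_mul_norm, hPQ, mul_add]
    exact add_le_add (mul_le_mul_of_nonneg_right (min_le_left _ _) h3)
      (mul_le_mul_of_nonneg_right (min_le_right _ _) h4)
  let γ : V →L[ℝ] V →L[ℝ] ℝ := c • (innerSL ℝ).bilinearComp Q Q
  let A := InnerProductSpace.continuousLinearMapOfBilin (𝕜 := ℝ) γ
  let S := hco.continuousLinearEquivOfBilin
  have hT : ∀ κ ψ, a * inner ℝ (P (S.symm (A κ))) (P ψ) + b * inner ℝ (Q (S.symm (A κ))) (Q ψ) =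
      c * inner ℝ (Q κ) (Q ψ) := fun κ ψ => by
    rw [← hβ, ← hco.continuousLinearEquivOfBilin_apply, ContinuousLinearEquiv.apply_symm_apply]
    exact InnerProductSpace.continuousLinearMapOfBilin_apply γ κ ψ
  refine ⟨S.symm.toContinuousLinearMap.comp A, hT, fun T h => ?_⟩
  ext1 κ
  exact eq_of_weighted_inner_eq hPQ ha hb fun ψ => (h κ ψ).trans (hT κ ψ).symm

end Coercive

section Surface

variable {d : ℕ} {Γ : Set (Space d)}

theorem inner_H1 (v w : H1 Γ) : inner ℝ v w =
    inner ℝ (l2PartL Γ v) (l2PartL Γ w) + inner ℝ (gradPartL Γ v) (gradPartL Γ w) := rfl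

theorem existsUnique_isIntermediateSurfaceDiffusion {a b : ℝ} (ha : 0 < a) (hb : 0 < b) :
    ∃! T : H1 Γ →L[ℝ] H1 Γ, IsIntermediateSurfaceDiffusion Γ a b T :=
  existsUnique_weighted_inner_eq inner_H1 ha hb sigma

theorem IsIntermediateSurfaceDiffusion.apply_eigenvector {a b : ℝ} (ha : 0 < a) (hb : 0 < b)
    {T : H1 Γ →L[ℝ] H1 Γ} (hT : IsIntermediateSurfaceDiffusion Γ a b T) {lam : ℝ}
    (hlam : 0 < lam) {e : H1 Γ} (he : IsEigenvector lam e) :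
    T e = (sigma * lam * (a + b * lam)⁻¹) • e := by
  refine eq_of_weighted_inner_eq inner_H1 ha hb fun ψ => (hT e ψ).trans ?_
  have h1 := he ψ
  have hne : a + b * lam ≠ 0 := by positivity
  simp only [map_smul, real_inner_smul_left, l2PartL_apply, gradPartL_apply]
  rw [h1]
  field_simp

/-- The Dirichlet form is symmetric, so testing each equation with the other eigenvector gives `(lam
- lam') (e, e') = 0`. -/
theorem IsEigenvector.inner_eq_zero {lam lam' : ℝ} {e e' : H1 Γ} (he : IsEigenvector lam e)
    (he' : IsEigenvector lam' e') (hne : lam ≠ lam') : inner ℝ (l2Part e) (l2Part e') = 0 := by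
  have h1 := he e'
  have h2 := he' e
  rw [real_inner_comm, real_inner_comm (l2Part e)] at h2
  have h3 : (lam - lam') * inner ℝ (l2Part e) (l2Part e') = 0 := by linarith
  exact (mul_eq_zero.1 h3).resolve_left (sub_ne_zero.2 hne)

/-- The eigenspace of `-Δ_Γ`. -/
def eigenspace (Γ : Set (Space d)) (lam : ℝ) : Submodule ℝ (H1 Γ) where
  carrier := {e | IsEigenvector lam e}
  add_mem' {e e'} he he' ψ := by
    have h1 := he ψ
    have h2 := he' ψ
    simp only [← l2PartL_apply, ← gradPartL_apply, map_add, inner_add_left] at h1 h2 ⊢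
    linarith
  zero_mem' ψ := by
    simp only [← l2PartL_apply, ← gradPartL_apply, map_zero, inner_zero_left, mul_zero]
  smul_mem' c e he ψ := by
    have h1 := he ψ
    simp only [← l2PartL_apply, ← gradPartL_apply, map_smul, real_inner_smul_left] at h1 ⊢
    linear_combination c * h1

end Surface

theorem norm_sq_sum_of_pairwise_orthogonal {ι E : Type*} [NormedAddCommGroup E]
    [InnerProductSpace ℝ E] (s : Finset ι) (v : ι → E)
    (h : ∀ i ∈ s, ∀ j ∈ s, i ≠ j → inner ℝ (v i) (v j) = 0) :
    ‖∑ i ∈ s, v i‖ ^ 2 = ∑ i ∈ s, ‖v i‖ ^ 2 := by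
  rw [← real_inner_self_eq_norm_sq, sum_inner]
  refine Finset.sum_congr rfl fun i hi => ?_
  rw [inner_sum, Finset.sum_eq_single_of_mem i hi fun j hj hji => h i hi j hj hji.symm,
    real_inner_self_eq_norm_sq]

/-- Pythagoras on both sides; orthogonality keeps the constant independent of the number of terms.
-/
theorem norm_sum_smul_le_of_pairwise_orthogonal {ι E : Type*} [NormedAddCommGroup E]
    [InnerProductSpace ℝ E] (s : Finset ι) (v : ι → E)
    (h : ∀ i ∈ s, ∀ j ∈ s, i ≠ j → inner ℝ (v i) (v j) = 0) {c : ι → ℝ} {M : ℝ} (hM : 0 ≤ M)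
    (hc : ∀ i ∈ s, |c i| ≤ M) : ‖∑ i ∈ s, c i • v i‖ ≤ M * ‖∑ i ∈ s, v i‖ := by
  refine le_of_sq_le_sq ?_ (by positivity)
  rw [mul_pow, norm_sq_sum_of_pairwise_orthogonal s v h,
    norm_sq_sum_of_pairwise_orthogonal s (fun i => c i • v i) fun i hi j hj hij => by
      rw [real_inner_smul_left, real_inner_smul_right, h i hi j hj hij, mul_zero, mul_zero],
    Finset.mul_sum]
  refine Finset.sum_le_sum fun i hi => ?_
  rw [norm_smul, mul_pow, Real.norm_eq_abs]
  gcongr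
  exact hc i hi

/-! ### Hyperbolic functions -/

theorem sinh_le_mul_cosh {x : ℝ} (hx : 0 ≤ x) : Real.sinh x ≤ x * Real.cosh x := by
  have hd : ∀ y, HasDerivAt (fun y => y * Real.cosh y - Real.sinh y) (y * Real.sinh y) y := by
    intro y
    refine (((hasDerivAt_id y).mul (Real.hasDerivAt_cosh y)).sub
      (Real.hasDerivAt_sinh y)).congr_deriv ?_
    simp
  have hmono : MonotoneOn (fun y => y * Real.cosh y - Real.sinh y) (Ici 0) := by
    refine monotoneOn_of_deriv_nonneg (convex_Ici 0)
      (fun y _ => (hd y).continuousAt.continuousWithinAt)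
      (fun y _ => (hd y).differentiableAt.differentiableWithinAt) fun y hy => ?_
    rw [interior_Ici] at hy
    rw [(hd y).deriv]
    exact mul_nonneg (le_of_lt hy) (Real.sinh_nonneg_iff.2 (le_of_lt hy))
  have := hmono (mem_Ici.2 le_rfl) (mem_Ici.2 hx) hx
  simp only [zero_mul, Real.sinh_zero, sub_zero] at this
  linarith

/-- By half-angle formulas `cosh x = 1 + 2 sinh²(x/2)`; then `x ≤ sinh x` handles the 1, and one
factor `sinh(x/2) ≤ x cosh(x/2)` turns the rest into `x² sinh x`. -/
theorem mul_cosh_le {x : ℝ} (hx : 0 ≤ x) :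
    x * Real.cosh x ≤ Real.sinh x + x ^ 2 * Real.sinh x := by
  have h1 := sinh_le_mul_cosh (x := x / 2) (by linarith)
  have h2 := Real.self_le_sinh_iff.2 hx
  have h3 : Real.cosh x = 1 + 2 * Real.sinh (x / 2) ^ 2 := by
    have := Real.cosh_two_mul (x / 2)
    rw [mul_div_cancel₀ x (by norm_num : (2 : ℝ) ≠ 0)] at this
    rw [this, Real.cosh_sq]; ring
  have h4 : Real.sinh x = 2 * Real.sinh (x / 2) * Real.cosh (x / 2) := by
    have := Real.sinh_two_mul (x / 2)
    rwa [mul_div_cancel₀ x (by norm_num : (2 : ℝ) ≠ 0)] at this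
  have h5 : 0 ≤ Real.sinh (x / 2) := Real.sinh_nonneg_iff.2 (by linarith)
  have h6 := Real.cosh_pos (x / 2)
  have h7 : x * Real.sinh (x / 2) * Real.sinh (x / 2) ≤
      x * Real.sinh (x / 2) * (x * Real.cosh (x / 2)) := by
    refine mul_le_mul_of_nonneg_left ?_ (by positivity)
    nlinarith [mul_nonneg hx h6.le]
  have h8 : x ^ 2 * Real.sinh x = 2 * (x * Real.sinh (x / 2) * (x * Real.cosh (x / 2))) := by
    rw [h4]; ring
  rw [h8, h3]
  linarith

/-- The denominator of the symbol, where `w` is the total weight. -/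
def symbolDenom (w ε lam : ℝ) : ℝ :=
  w * lam * (Real.sinh (ε * Real.sqrt lam * (w / 2)) /
      (ε * Real.sqrt lam * (w / 2) * Real.cosh (ε * Real.sqrt lam * (w / 2)))) +
    4 / w * (ε * Real.sqrt lam * (w / 2) * Real.cosh (ε * Real.sqrt lam * (w / 2)) /
      Real.sinh (ε * Real.sqrt lam * (w / 2)))

/-- With `x = ε √lam w/2` the two quotients satisfy `1 - x² ≤ (tanh x)/x ≤ 1` and `1 ≤ x coth x ≤ 1
+ x²`. -/
theorem symbolDenom_bounds {w ε lam : ℝ} (hw : 0 < w) (hε : 0 < ε) (hlam : 0 < lam) :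
    4 / w ≤ symbolDenom w ε lam ∧
      |symbolDenom w ε lam - (4 / w + w * lam)| ≤
        (w * lam + 4 / w) * (ε ^ 2 * lam * (w / 2) ^ 2) := by
  have hs := Real.sqrt_pos.2 hlam
  have hx2 : ε ^ 2 * lam * (w / 2) ^ 2 = (ε * Real.sqrt lam * (w / 2)) ^ 2 := by
    rw [mul_pow, mul_pow, Real.sq_sqrt hlam.le]
  rw [hx2, symbolDenom]
  have hx : 0 < ε * Real.sqrt lam * (w / 2) := by positivity
  set x := ε * Real.sqrt lam * (w / 2)
  have hsh : 0 < Real.sinh x := Real.sinh_pos_iff.2 hx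
  have hch := Real.cosh_pos x
  have h1 := sinh_le_mul_cosh hx.le
  have h2 := mul_cosh_le hx.le
  have h3 : 1 ≤ x * Real.cosh x / Real.sinh x := by rwa [one_le_div hsh]
  have h4 : x * Real.cosh x / Real.sinh x ≤ 1 + x ^ 2 := by
    rw [div_le_iff₀ hsh]; linarith
  have h5 : Real.sinh x / (x * Real.cosh x) ≤ 1 := by rwa [div_le_one (by positivity)]
  have h6 : 1 - x ^ 2 ≤ Real.sinh x / (x * Real.cosh x) := by
    rw [le_div_iff₀ (by positivity)]
    have := mul_le_mul_of_nonneg_left h1 (sq_nonneg x)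
    linarith
  have h7 : 0 < Real.sinh x / (x * Real.cosh x) := by positivity
  have hw4 : 0 < 4 / w := by positivity
  have hwl : 0 < w * lam := by positivity
  constructor
  · have := mul_le_mul_of_nonneg_left h3 hw4.le
    have := mul_pos hwl h7
    linarith
  · have e1 := mul_le_mul_of_nonneg_left h3 hw4.le
    have e2 := mul_le_mul_of_nonneg_left h4 hw4.le
    have e3 := mul_le_mul_of_nonneg_left h5 hwl.le
    have e4 := mul_le_mul_of_nonneg_left h6 hwl.le
    have e5 : 0 ≤ 4 / w * x ^ 2 := by positivity
    have e6 : 0 ≤ w * lam * x ^ 2 := by positivity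
    rw [abs_le]
    constructor <;> linarith

/-! ### The explicit profile and the symbol -/

section Symbol

variable {d : ℕ} {Γ : Set (Space d)} {m B W : ℝ → ℝ} {ε : ℝ}

theorem IsWeight.integral_pos (hW : IsWeight m B ε W) : 0 < ∫ u in (-1 : ℝ)..1, W u :=
  intervalIntegral.intervalIntegral_pos_of_pos_on (hW.continuous.intervalIntegrable _ _)
    hW.pos (by norm_num)

variable [IsFiniteMeasure (surfaceMeasure Γ)]

/-- The propagation operator is diagonal in the eigenvectors of `-Δ_Γ`. -/
theorem IsPropagationOperator.apply_eigenvector (hΓ : IsCompact Γ) (hW : IsWeight m B ε W)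
    {G : H1 Γ →L[ℝ] StrongDual ℝ (H1 Γ)} (hG : IsPropagationOperator Γ m B (affineCoupling ε) G)
    {lam : ℝ} (hlam : 0 < lam) {e : H1 Γ} (he : IsEigenvector lam e) :
    G e = (sigma * lam * (symbolDenom (∫ u in (-1 : ℝ)..1, W u) ε lam)⁻¹) • l2Functional e := by
  have hw := hW.integral_pos
  have hε := hW.slope_pos
  have hD := (symbolDenom_bounds hw hε hlam).1
  set w := ∫ u in (-1 : ℝ)..1, W u with hwdef
  have hD0 : symbolDenom w ε lam ≠ 0 := (lt_of_lt_of_le (by positivity) hD).ne'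
  set V := sigma * lam * (symbolDenom w ε lam)⁻¹ with hV
  have hμ := Real.sqrt_pos.2 hlam
  have hμ2 := Real.sq_sqrt hlam.le
  set μ := Real.sqrt lam with hμdef
  have hx : 0 < ε * μ * (w / 2) := by positivity
  have hsh : Real.sinh (ε * μ * (w / 2)) ≠ 0 := (Real.sinh_pos_iff.2 hx).ne'
  have hch : Real.cosh (ε * μ * (w / 2)) ≠ 0 := (Real.cosh_pos _).ne'
  -- The sum and the difference of the flux conditions at `u = ±1` determine `β` and `α` separately,
  -- since `t` is centred so that `t(±1) = ±w/2`.
  let α := ε * V / (μ * Real.sinh (ε * μ * (w / 2)))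
  let β := V / (μ * Real.cosh (ε * μ * (w / 2)))
  let t : ℝ → ℝ := fun u => (∫ v in (-1 : ℝ)..u, W v) - w / 2
  have ht : ∀ u, HasDerivAt t (W u) u := fun u =>
    (intervalIntegral.integral_hasDerivAt_right (hW.continuous.intervalIntegrable _ _)
      (hW.continuous.stronglyMeasurableAtFilter _ _) hW.continuous.continuousAt).sub_const _
  have ht1 : ε * μ * t 1 = ε * μ * (w / 2) := by
    simp only [t, ← hwdef]; ring
  have ht2 : ε * μ * t (-1) = -(ε * μ * (w / 2)) := by
    simp only [t, intervalIntegral.integral_same]; ring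
  let p : ℝ → ℝ := fun u => α * Real.cosh (ε * μ * t u) + β * Real.sinh (ε * μ * t u)
  let K : ℝ → ℝ := fun u =>
    ε⁻¹ * μ * (α * Real.sinh (ε * μ * t u) + β * Real.cosh (ε * μ * t u))
  have hp : ∀ u, HasDerivAt p (ε ^ 2 * W u * K u) u := fun u => by
    refine ((((ht u).const_mul (ε * μ)).cosh.const_mul α).add
      (((ht u).const_mul (ε * μ)).sinh.const_mul β)).congr_deriv ?_
    simp only [K]
    field_simp
  have hK : ∀ u, HasDerivAt K (lam * W u * p u) u := fun u => by
    refine (((((ht u).const_mul (ε * μ)).sinh.const_mul α).add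
      (((ht u).const_mul (ε * μ)).cosh.const_mul β)).const_mul (ε⁻¹ * μ)).congr_deriv ?_
    simp only [p]
    rw [← hμ2]
    field_simp
  have hKc : Continuous K := continuous_iff_continuousAt.2 fun u => (hK u).continuousAt
  have hWc := hW.continuous
  have hq : Continuous fun u => ε ^ 2 * W u * K u := by fun_prop
  have h1 : K 1 = V * (ε⁻¹ * (1 + ε)) := by
    simp only [K, ht1, α, β]
    field_simp
    ring
  have h2 : K (-1) = V * (ε⁻¹ * (1 - ε)) := by
    simp only [K, ht2, α, β, Real.sinh_neg, Real.cosh_neg]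
    field_simp
    ring
  -- The constraint of `p` is `V D / lam`, with `D` the denominator of the symbol; this fixes the
  -- value chosen for `V`.
  have h3 : boundaryValue ε p = sigma := by
    have hVD : V * symbolDenom w ε lam = sigma * lam := by
      rw [hV, mul_assoc, inv_mul_cancel₀ hD0, mul_one]
    have h4 : boundaryValue ε p = V * symbolDenom w ε lam / lam := by
      simp only [boundaryValue, p, ht1, ht2, Real.sinh_neg, Real.cosh_neg, α, β, symbolDenom,
        ← hμdef]
      rw [← hμ2]
      field_simp
      ring
    rw [h4, hVD, mul_div_cancel_right₀ _ hlam.ne']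
  obtain ⟨f, hf⟩ := hG e
  exact hf.multiplier_unique hW (isConstrainedSolution_separated hΓ hW hp hq hK h1 h2 h3 he)

end Symbol

end


/-! ### The concrete coefficients and comparison of the operators -/

noncomputable section

/-- The continuous extension of `mt(u) √(1-u²)` by zero. -/
def weight (mt : ℝ → ℝ) (u : ℝ) : ℝ :=
  mt (projIcc (-1 : ℝ) 1 (by norm_num) u) * Real.sqrt (1 - u ^ 2)

theorem weight_eq (mt : ℝ → ℝ) {u : ℝ} (hu : u ∈ Icc (-1 : ℝ) 1) :
    weight mt u = mt u * Real.sqrt (1 - u ^ 2) := by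
  rw [weight, projIcc_of_mem _ hu]

theorem isWeight_weight {mt m B : ℝ → ℝ} {ε : ℝ} (hmt : ContinuousOn mt (Icc (-1) 1))
    (hpos : ∀ u ∈ Icc (-1 : ℝ) 1, 0 < mt u)
    (hm : ∀ u ∈ Icc (-1 : ℝ) 1, m u = (1 - u ^ 2) * mt u) (hε : 0 < ε) (hε1 : ε < 1)
    (hB : ∀ u ∈ Icc (-1 : ℝ) 1, B u = affineCoupling ε u ^ 4 * mt u) :
    IsWeight m B ε (weight mt) := by
  have hc : Continuous fun u => mt (projIcc (-1 : ℝ) 1 (by norm_num) u) :=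
    hmt.comp_continuous (continuous_subtype_val.comp continuous_projIcc) fun u => Subtype.coe_prop _
  have hp : ∀ u, 0 < mt (projIcc (-1 : ℝ) 1 (by norm_num) u) := fun u => hpos _ (Subtype.coe_prop _)
  refine ⟨hc.mul (by fun_prop), fun u => mul_nonneg (hp u).le (Real.sqrt_nonneg _),
    fun u hu => mul_pos (hp u) (Real.sqrt_pos.2 ?_), ?_, hε, hε1, fun u hu => ?_, fun u hu => ?_⟩
  · nlinarith [hu.1, hu.2]
  -- `1/W` is the Chebyshev weight `1/√(1-u²)` times the continuous function `1/mt`.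
  · have h1 := Polynomial.Chebyshev.intervalIntegrable_sqrt_one_sub_sq_inv.continuousOn_mul
      (hc.inv₀ fun u => (hp u).ne').continuousOn
    rw [intervalIntegrable_iff_integrableOn_Icc_of_le (by norm_num)] at h1
    refine h1.congr (Filter.Eventually.of_forall fun u => ?_)
    simp only [weight, mul_inv, Real.sqrt_inv, Pi.inv_apply]
  -- `n > 0` on the interval because `ε < 1`, so the factor `n⁴` in `B` cancels against `(n²/n')²`.
  · have hn : 0 < affineCoupling ε u := by
      unfold affineCoupling
      nlinarith [hu.1, hu.2]
    have hmu := hpos u hu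
    rw [ellipticCoeff, hB u hu, (hasDerivAt_affineCoupling ε u).deriv, weight_eq mt hu,
      div_eq_mul_inv _ (Real.sqrt _), mul_inv, mul_inv, mul_inv]
    field_simp
  · rw [scaledMobility, hm u hu, weight_eq mt hu]
    have h0 : 0 ≤ 1 - u ^ 2 := by nlinarith [hu.1, hu.2]
    rw [mul_comm, mul_div_assoc, Real.div_sqrt]

theorem omega_eq (mt : ℝ → ℝ) : omega mt = ∫ u in (-1 : ℝ)..1, weight mt u := by
  refine intervalIntegral.integral_congr fun u hu => ?_
  rw [uIcc_of_le (by norm_num)] at hu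
  exact (weight_eq mt hu).symm

theorem IsWeight.delta_eq {m B W : ℝ → ℝ} {ε : ℝ} (hW : IsWeight m B ε W) :
    delta m = 4 / ∫ u in (-1 : ℝ)..1, W u := by
  rw [delta, div_eq_mul_inv]
  congr 2
  refine intervalIntegral.integral_congr fun u hu => ?_
  rw [uIcc_of_le (by norm_num)] at hu
  exact hW.scaledMobility_eq u hu

/-- Two operators which are diagonal on the eigenvectors of `-Δ_Γ` with eigenvalues in `(0,R]`
differ at most by the difference of their symbols. -/
theorem abs_sub_le_of_diagonal {d : ℕ} {Γ : Set (Space d)} {R M : ℝ} (hM : 0 ≤ M)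
    {G : H1 Γ →L[ℝ] StrongDual ℝ (H1 Γ)} {T : H1 Γ →L[ℝ] H1 Γ} {g h : ℝ → ℝ}
    (hG : ∀ lam, 0 < lam → ∀ e : H1 Γ, IsEigenvector lam e → G e = g lam • l2Functional e)
    (hT : ∀ lam, 0 < lam → ∀ e : H1 Γ, IsEigenvector lam e → T e = h lam • e)
    (hgh : ∀ lam, 0 < lam → lam ≤ R → |g lam - h lam| ≤ M) {κ : H1 Γ}
    (hκ : κ ∈ Submodule.span ℝ
      {e : H1 Γ | ∃ lam : ℝ, 0 < lam ∧ lam ≤ R ∧ IsEigenvector lam e}) (ψ : H1 Γ) :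
    |G κ ψ - inner ℝ (l2Part (T κ)) (l2Part ψ)| ≤ M * ‖l2Part κ‖ * ‖l2Part ψ‖ := by
  -- Terms are grouped by eigenvalue, so that distinct summands are orthogonal even when the given
  -- eigenfunctions are not.
  have hle : Submodule.span ℝ {e : H1 Γ | ∃ lam : ℝ, 0 < lam ∧ lam ≤ R ∧ IsEigenvector lam e} ≤
      ⨆ lam : {lam : ℝ // 0 < lam ∧ lam ≤ R}, eigenspace Γ lam := by
    refine Submodule.span_le.2 ?_
    rintro e ⟨lam, h1, h2, he⟩
    exact Submodule.mem_iSup_of_mem (p := fun lam : {lam : ℝ // 0 < lam ∧ lam ≤ R} =>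
      eigenspace Γ lam) ⟨lam, h1, h2⟩ he
  obtain ⟨f, hf, rfl⟩ := (Submodule.mem_iSup_iff_exists_finsupp _ _).1 (hle hκ)
  have hf' : ∀ i : {lam : ℝ // 0 < lam ∧ lam ≤ R}, IsEigenvector (i : ℝ) (f i) := hf
  have h1 : G (f.sum fun _ x => x) ψ - inner ℝ (l2Part (T (f.sum fun _ x => x))) (l2Part ψ) =
      inner ℝ (∑ i ∈ f.support, (g i - h i) • l2Part (f i)) (l2Part ψ) := by
    simp only [← l2PartL_apply, Finsupp.sum, map_sum, _root_.sum_apply, sum_inner,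
      ← Finset.sum_sub_distrib]
    refine Finset.sum_congr rfl fun i _ => ?_
    rw [hG i i.2.1 _ (hf' i), hT i i.2.1 _ (hf' i), map_smul, real_inner_smul_left,
      real_inner_smul_left, sub_mul]
    rfl
  have h2 : l2Part (f.sum fun _ x => x) = ∑ i ∈ f.support, l2Part (f i) := by
    simp only [← l2PartL_apply, Finsupp.sum, map_sum]
  rw [h1, h2]
  refine (abs_real_inner_le_norm _ _).trans (mul_le_mul_of_nonneg_right ?_ (norm_nonneg _))
  exact norm_sum_smul_le_of_pairwise_orthogonal _ (fun i => l2Part (f i))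
    (fun i _ j _ hij => (hf' i).inner_eq_zero (hf' j) fun h => hij (Subtype.ext h)) hM
    fun i _ => hgh i i.2.1 i.2.2

theorem abs_symbol_sub_le {D D₀ a s lam R r : ℝ} (ha : 0 < a) (hD : a ≤ D) (hD₀ : a ≤ D₀)
    (hlam : 0 < lam) (hlamR : lam ≤ R) (hr : |D - D₀| ≤ r) :
    |s * lam * D⁻¹ - s * lam * D₀⁻¹| ≤ |s| * R * r / a ^ 2 := by
  have hD' := ha.trans_le hD
  have hD₀' := ha.trans_le hD₀
  have h1 : s * lam * D⁻¹ - s * lam * D₀⁻¹ = s * lam * (D₀ - D) / (D * D₀) := by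
    field_simp
  rw [h1, abs_div, abs_mul, abs_mul, abs_of_pos hlam, abs_sub_comm, abs_of_pos (mul_pos hD' hD₀'),
    sq]
  have hR : 0 ≤ R := hlam.le.trans hlamR
  have hr0 : 0 ≤ r := (abs_nonneg _).trans hr
  gcongr

end

end ViscoPhase

open ViscoPhase in
theorem mainTheorem6
    (mt : ℝ → ℝ) (hmt : ContDiffOn ℝ ∞ mt (Icc (-1) 1))
    (hmt_pos : ∀ u ∈ Icc (-1 : ℝ) 1, 0 < mt u)
    (m : ℝ → ℝ) (hm : ∀ u ∈ Icc (-1 : ℝ) 1, m u = (1 - u ^ 2) * mt u)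
    (hm_even : ∀ u ∈ Icc (-1 : ℝ) 1, m (-u) = m u)
    (R : ℝ) :
    ∃ C ε₀ : ℝ, 0 < C ∧ 0 < ε₀ ∧ ε₀ ≤ 1 ∧
      ∀ (d : ℕ), 2 ≤ d → ∀ Γ : Set (Space d), IsClosedHypersurface Γ →
      ∀ ε : ℝ, 0 < ε → ε < ε₀ →
      ∀ A τ : ℝ → ℝ, ContDiffOn ℝ ∞ A (Icc (-1) 1) → ContDiffOn ℝ ∞ τ (Icc (-1) 1) →
        (∀ u ∈ Icc (-1 : ℝ) 1, A u ^ 2 * τ u = affineCoupling ε u ^ 4 * mt u) →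
        -- the two propagation operators are well defined
        (∃! G : H1 Γ →L[ℝ] StrongDual ℝ (H1 Γ),
          IsPropagationOperator Γ m (fun u => A u ^ 2 * τ u) (affineCoupling ε) G) ∧
        (∃! T : H1 Γ →L[ℝ] H1 Γ, IsIntermediateSurfaceDiffusion Γ (delta m) (omega mt) T) ∧
        ∀ (G : H1 Γ →L[ℝ] StrongDual ℝ (H1 Γ)) (T : H1 Γ →L[ℝ] H1 Γ),
          IsPropagationOperator Γ m (fun u => A u ^ 2 * τ u) (affineCoupling ε) G →
          IsIntermediateSurfaceDiffusion Γ (delta m) (omega mt) T →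
          -- the symbol of `G` at frequencies `lam ≤ R`
          (∃ ρ : ℝ → ℝ,
            (∀ lam : ℝ, 0 < lam → lam ≤ R →
              |ρ lam| ≤ C * ε ∧ 0 < delta m + omega mt * lam + ρ lam) ∧
            ∀ (lam : ℝ) (e : H1 Γ), 0 < lam → lam ≤ R → IsEigenvector lam e → ‖l2Part e‖ = 1 →
              G e e = sigma * lam * (delta m + omega mt * lam + ρ lam)⁻¹) ∧
          -- `G` agrees with `T` up to `O(ε)` on the span of the eigenfunctions with `lam ≤ R`
          (∀ κ ∈ Submodule.span ℝ {e : H1 Γ | ∃ lam : ℝ, 0 < lam ∧ lam ≤ R ∧ IsEigenvector lam e},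
            ∀ ψ : H1 Γ, |G κ ψ - inner ℝ (l2Part (T κ)) (l2Part ψ)| ≤ C * ε * ‖l2Part κ‖ * ‖l2Part ψ‖) := by
  have hweight : ∀ {B : ℝ → ℝ} {ε : ℝ}, 0 < ε → ε < 1 →
      (∀ u ∈ Icc (-1 : ℝ) 1, B u = affineCoupling ε u ^ 4 * mt u) →
      IsWeight m B ε (weight mt) := fun hε hε1 hB =>
    isWeight_weight hmt.continuousOn hmt_pos hm hε hε1 hB
  -- The slope `1/2` is arbitrary: `w > 0` and `δ = 4/w` do not depend on it, and they are needed
  -- before `ε` is given.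
  have hW₀ := hweight (ε := 1 / 2) (by norm_num) (by norm_num) (fun _ _ => rfl)
  set w := ∫ u in (-1 : ℝ)..1, weight mt u with hwdef
  have hw : 0 < w := hW₀.integral_pos
  have hom : omega mt = w := omega_eq mt
  have hdel : delta m = 4 / w := hW₀.delta_eq
  have h4w : 0 < 4 / w := by positivity
  -- `C₁` bounds the error of the denominator; `C₂` passes it to the symbol, both denominators being
  -- at least `4 / w`. Using `|R|` keeps both nonnegative for every `R`.
  set C₁ := (w * |R| + 4 / w) * (|R| * (w / 2) ^ 2) with hC₁
  have hC₁0 : 0 ≤ C₁ := by positivity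
  set C₂ := |sigma| * |R| * C₁ / (4 / w) ^ 2 with hC₂
  have hC₂0 : 0 ≤ C₂ := by positivity
  refine ⟨C₁ + C₂ + 1, 1, by positivity, one_pos, le_rfl, ?_⟩
  intro d _ Γ hΓ ε hε hε1 A τ _ _ hB
  have := hΓ.isFiniteMeasure_surfaceMeasure
  have hW : IsWeight m (fun u => A u ^ 2 * τ u) ε (weight mt) := hweight hε hε1 hB
  rw [hom, hdel]
  refine ⟨existsUnique_isPropagationOperator hW,
    existsUnique_isIntermediateSurfaceDiffusion h4w hw, fun G T hG hT => ?_⟩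
  have hbound : ∀ lam, 0 < lam → lam ≤ R →
      |symbolDenom w ε lam - (4 / w + w * lam)| ≤ C₁ * ε := fun lam h0 hR => by
    refine (symbolDenom_bounds hw hε h0).2.trans ?_
    have hR' : lam ≤ |R| := hR.trans (le_abs_self R)
    -- The error is in fact of order `ε²`; one factor is given away.
    have hε2 : ε ^ 2 ≤ ε := by nlinarith
    calc (w * lam + 4 / w) * (ε ^ 2 * lam * (w / 2) ^ 2)
        ≤ (w * |R| + 4 / w) * (ε * |R| * (w / 2) ^ 2) := by gcongr
      _ = C₁ * ε := by rw [hC₁]; ring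
  have hGe : ∀ lam, 0 < lam → ∀ e : H1 Γ, IsEigenvector lam e →
      G e = (sigma * lam * (symbolDenom w ε lam)⁻¹) • l2Functional e := fun lam h0 e he =>
    hG.apply_eigenvector hΓ.isCompact hW h0 he
  constructor
  · refine ⟨fun lam => symbolDenom w ε lam - (4 / w + w * lam), fun lam h0 hR => ⟨?_, ?_⟩,
      fun lam e h0 hR he hnorm => ?_⟩
    · refine (hbound lam h0 hR).trans (mul_le_mul_of_nonneg_right ?_ hε.le)
      linarith
    · rw [add_sub_cancel]
      exact h4w.trans_le (symbolDenom_bounds hw hε h0).1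
    · rw [add_sub_cancel, hGe lam h0 e he, _root_.smul_apply, l2Functional_apply,
        real_inner_self_eq_norm_sq, hnorm, one_pow, smul_eq_mul, mul_one]
  · intro κ hκ ψ
    refine abs_sub_le_of_diagonal (by positivity) hGe
      (fun lam h0 e he => hT.apply_eigenvector h4w hw h0 he) (fun lam h0 hR => ?_) hκ ψ
    have hwl : 0 < w * lam := by positivity
    refine (abs_symbol_sub_le h4w (symbolDenom_bounds hw hε h0).1 (by linarith) h0
      (hR.trans (le_abs_self R)) (hbound lam h0 hR)).trans ?_
    calc |sigma| * |R| * (C₁ * ε) / (4 / w) ^ 2 = C₂ * ε := by rw [hC₂]; ring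
      _ ≤ (C₁ + C₂ + 1) * ε := mul_le_mul_of_nonneg_right (by linarith) hε.le
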